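/- Let $N\ge 2$, let $\Omega\subset\mathbb R^N$ be a bounded open set with Lipschitz boundary and $0\in\Omega$, let $2\le p<q<N$ with $\frac qp<1+\frac1N$, and let $a:\overline\Omega\to[0,\infty)$ be Lipschitz continuous with $a(\lambda x)\le a(x)$ whenever $\lambda\in(0,1]$ and $x,\lambda x\in\overline\Omega$. Put $\mathcal H(x,t)=t^p+a(x)t^q$. Let $L^{\mathcal H}(\Omega)$ be the space of measurable functions $u$ on $\Omega$ (up to a.e. equality) with $\varrho_{\mathcal H}(u)=\int_\Omega\mathcal H(x,|u|)\,dx<\infty$, with the Luxemburg norm $\|u\|_{\mathcal H}=\inf\{\lambda>0:\varrho_{\mathcal H}(u/\lambda)\le1\}$; let $W^{1,\mathcal H}(\Omega)$ be the space of $u\in L^{\mathcal H}(\Omega)$ whose weak gradient satisfies $|\nabla u|\in L^{\mathcal H}(\Omega)$, with the norm $\|u\|_{\mathcal H}+\||\nabla u|\|_{\mathcal H}$; and let $W^{1,\mathcal H}_0(\Omega)$ be the closure of $C_0^\infty(\Omega)$ in $W^{1,\mathcal H}(\Omega)$. For $m\in\{p,q\}$ let $H_m=\left(\frac{m}{N-m}\right)^{-m}$,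 and let $\kappa_m>0$ be any constant such that $$|\xi-\eta|^m\le\kappa_m\left(|\xi|^{m-2}\xi-|\eta|^{m-2}\eta\right)\cdot(\xi-\eta)\qquad\text{for all }\xi,\eta\in\mathbb R^N.$$ Let $\gamma\in\mathbb R$ satisfy $\gamma<\dfrac{\min\{H_p,H_q\}}{\max\{\kappa_p,\kappa_q\}}$. Then $$\langle L_\gamma(u),v\rangle=\int_\Omega\left(|\nabla u|^{p-2}+a(x)|\nabla u|^{q-2}\right)\nabla u\cdot\nabla v\,dx-\gamma\int_\Omega\left(\frac{|u|^{p-2}u}{|x|^p}v+a(x)\frac{|u|^{q-2}u}{|x|^q}v\right)dx$$ defines, with absolutely convergent integrals, an operator $L_\gamma:W^{1,\mathcal H}_0(\Omega)\to\left(W^{1,\mathcal H}_0(\Omega)\right)^*$, and $L_\gamma$ is of type $(S)$: if $u_j\rightharpoonup u$ weakly in $W^{1,\mathcal H}_0(\Omega)$ and $\lim_{j\to\infty}\langle L_\gamma(u_j)-L_\gamma(u),u_j-u\rangle=0$, then $u_j\to u$ in $W^{1,\mathcal H}_0(\Omega)$. -/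

import Mathlib

open MeasureTheory Filter Topology
open scoped ENNReal NNReal ContDiff

noncomputable section

/-- An open set `Ω` has Lipschitz boundary: near each boundary point it is, after choosing a unit
direction `ν`, the set of points lying strictly above the graph of a Lipschitz function of the
component orthogonal to `ν`. -/
def HasLipschitzBoundary {N : ℕ} (Ω : Set (EuclideanSpace ℝ (Fin N))) : Prop :=
  ∀ x₀ ∈ frontier Ω, ∃ (ν : EuclideanSpace ℝ (Fin N)) (r : ℝ) (K : ℝ≥0)
      (g : EuclideanSpace ℝ (Fin N) → ℝ),
    ‖ν‖ = 1 ∧ 0 < r ∧ LipschitzWith K g ∧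
      ∀ x ∈ Metric.ball x₀ r, (x ∈ Ω ↔ g (x - inner ℝ ν x • ν) < inner ℝ ν x)

/-- The data of the double phase problem in `ℝ^N`, with the standing assumptions:
a bounded open set `Ω ∋ 0` with Lipschitz boundary, exponents `1 < p < q < N` with
`q / p < 1 + 1 / N`, and a nonnegative Lipschitz weight `a` on the closure of `Ω` with
`a (l x) ≤ a x` for `0 < l ≤ 1`. Only the values of `a` on the closure of `Ω` matter. -/
structure DoublePhase (N : ℕ) where
  Ω : Set (EuclideanSpace ℝ (Fin N))
  p : ℝ
  q : ℝ
  a : EuclideanSpace ℝ (Fin N) → ℝ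
  two_le_dim : 2 ≤ N
  isOpen : IsOpen Ω
  isBounded : Bornology.IsBounded Ω
  lipschitzBoundary : HasLipschitzBoundary Ω
  zero_mem : (0 : EuclideanSpace ℝ (Fin N)) ∈ Ω
  one_lt_p : 1 < p
  p_lt_q : p < q
  q_lt_dim : q < N
  ratio_lt : q / p < 1 + 1 / (N : ℝ)
  a_nonneg : ∀ x ∈ closure Ω, 0 ≤ a x
  a_lipschitz : ∃ K : ℝ≥0, LipschitzOnWith K a (closure Ω)
  a_mono : ∀ l : ℝ, 0 < l → l ≤ 1 → ∀ x ∈ closure Ω, l • x ∈ closure Ω → a (l • x) ≤ a x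

namespace DoublePhase

variable {N : ℕ} (D : DoublePhase N)

/-- Lebesgue measure on `Ω`. -/
abbrev μ : Measure (EuclideanSpace ℝ (Fin N)) := volume.restrict D.Ω

/-- The generalized N-function `H(x, t) = t ^ p + a(x) t ^ q`. -/
def H (x : EuclideanSpace ℝ (Fin N)) (t : ℝ) : ℝ := t ^ D.p + D.a x * t ^ D.q

/-- The modular `∫_Ω H(x, |f(x)|) dx`, with values in `[0, ∞]`. -/
def modular {F : Type*} [NormedAddCommGroup F] (f : EuclideanSpace ℝ (Fin N) → F) : ℝ≥0∞ :=
  ∫⁻ x in D.Ω, ENNReal.ofReal (D.H x ‖f x‖)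

/-! Elementary facts about `H` and the modular. -/

section Facts

set_option linter.unusedSectionVars false

variable {D} {F : Type*} [NormedAddCommGroup F] [NormedSpace ℝ F]

lemma p_pos : 0 < D.p := by linarith [D.one_lt_p]
lemma q_pos : 0 < D.q := by linarith [D.one_lt_p, D.p_lt_q]

lemma a_nonneg' {x} (hx : x ∈ D.Ω) : 0 ≤ D.a x := D.a_nonneg x (subset_closure hx)

lemma H_zero (x) : D.H x 0 = 0 := by
  simp [H, Real.zero_rpow p_pos.ne', Real.zero_rpow (q_pos (D := D)).ne']

lemma H_nonneg {x} (hx : x ∈ D.Ω) {t : ℝ} (ht : 0 ≤ t) : 0 ≤ D.H x t := by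
  have := a_nonneg' hx
  unfold H; positivity

lemma H_mono {x} (hx : x ∈ D.Ω) {s t : ℝ} (hs : 0 ≤ s) (hst : s ≤ t) : D.H x s ≤ D.H x t := by
  have h := a_nonneg' hx
  have h1 := p_pos (D := D)
  have h2 := q_pos (D := D)
  unfold H; gcongr

lemma H_convex {x} (hx : x ∈ D.Ω) {s t b c : ℝ} (hs : 0 ≤ s) (ht : 0 ≤ t) (hb : 0 ≤ b)
    (hc : 0 ≤ c) (hbc : b + c = 1) : D.H x (b * s + c * t) ≤ b * D.H x s + c * D.H x t := by
  have h := a_nonneg' hx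
  have h1 := (convexOn_rpow D.one_lt_p.le).2 (Set.mem_Ici.2 hs) (Set.mem_Ici.2 ht) hb hc hbc
  have h2 := (convexOn_rpow (D.one_lt_p.trans D.p_lt_q).le).2
    (Set.mem_Ici.2 hs) (Set.mem_Ici.2 ht) hb hc hbc
  simp only [smul_eq_mul] at h1 h2
  have h3 := mul_le_mul_of_nonneg_left h2 h
  unfold H; linarith

lemma H_mul_le {x} (hx : x ∈ D.Ω) {s c : ℝ} (hs : 0 ≤ s) (hc : 1 ≤ c) :
    D.H x (c * s) ≤ c ^ D.q * D.H x s := by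
  have h := a_nonneg' hx
  have hc0 : 0 ≤ c := by linarith
  have h1 : c ^ D.p ≤ c ^ D.q := Real.rpow_le_rpow_of_exponent_le hc D.p_lt_q.le
  unfold H
  rw [Real.mul_rpow hc0 hs, Real.mul_rpow hc0 hs]
  have := mul_le_mul_of_nonneg_right h1 (Real.rpow_nonneg hs D.p)
  linarith

lemma aemeasurable_H {f : EuclideanSpace ℝ (Fin N) → F} (hf : AEStronglyMeasurable f D.μ) :
    AEMeasurable (fun x => ENNReal.ofReal (D.H x ‖f x‖)) D.μ := by
  obtain ⟨K, hK⟩ := D.a_lipschitz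
  have ha : AEMeasurable D.a D.μ :=
    (hK.continuousOn.mono subset_closure).aemeasurable D.isOpen.measurableSet
  have hn := hf.norm.aemeasurable
  unfold H
  exact ((hn.pow_const _).add (ha.mul (hn.pow_const _))).ennreal_ofReal

lemma modular_congr {f g : EuclideanSpace ℝ (Fin N) → F} (h : f =ᵐ[D.μ] g) :
    D.modular f = D.modular g :=
  lintegral_congr_ae (h.mono fun x hx => by simp only [hx])

lemma modular_mono {f g : EuclideanSpace ℝ (Fin N) → F} (h : ∀ x, ‖f x‖ ≤ ‖g x‖) :
    D.modular f ≤ D.modular g :=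
  setLIntegral_mono' D.isOpen.measurableSet fun x hx =>
    ENNReal.ofReal_le_ofReal (H_mono hx (norm_nonneg _) (h x))

lemma modular_convex {f g : EuclideanSpace ℝ (Fin N) → F} (hf : AEStronglyMeasurable f D.μ)
    {b c : ℝ} (hb : 0 ≤ b) (hc : 0 ≤ c) (hbc : b + c = 1) :
    D.modular (fun x => b • f x + c • g x)
      ≤ ENNReal.ofReal b * D.modular f + ENNReal.ofReal c * D.modular g := by
  unfold modular
  rw [← lintegral_const_mul' _ _ ENNReal.ofReal_ne_top,
    ← lintegral_const_mul' _ _ ENNReal.ofReal_ne_top,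
    ← lintegral_add_left' ((aemeasurable_H hf).const_mul _)]
  refine setLIntegral_mono' D.isOpen.measurableSet fun x hx => ?_
  rw [← ENNReal.ofReal_mul hb, ← ENNReal.ofReal_mul hc,
    ← ENNReal.ofReal_add (mul_nonneg hb (H_nonneg hx (norm_nonneg _)))
      (mul_nonneg hc (H_nonneg hx (norm_nonneg _)))]
  refine ENNReal.ofReal_le_ofReal (le_trans (H_mono hx (norm_nonneg _) ?_)
    (H_convex hx (norm_nonneg (f x)) (norm_nonneg (g x)) hb hc hbc))
  refine (norm_add_le _ _).trans (le_of_eq ?_)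
  rw [norm_smul, norm_smul, Real.norm_of_nonneg hb, Real.norm_of_nonneg hc]

lemma modular_zero : D.modular (fun _ => (0 : F)) = 0 := by
  simp [modular, H_zero]

/-- Scaling down: `ϱ(c f) ≤ c ϱ(f)` for `0 ≤ c ≤ 1`. -/
lemma modular_smul_le {f : EuclideanSpace ℝ (Fin N) → F} (hf : AEStronglyMeasurable f D.μ)
    {c : ℝ} (hc : 0 ≤ c) (hc1 : c ≤ 1) :
    D.modular (fun x => c • f x) ≤ ENNReal.ofReal c * D.modular f := by
  have := modular_convex (D := D) (g := fun _ => (0 : F)) hf hc (sub_nonneg.2 hc1) (by ring)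
  simpa [modular_zero] using this

lemma modular_smul_lt_top {f : EuclideanSpace ℝ (Fin N) → F} (hf : D.modular f < ⊤) (c : ℝ) :
    D.modular (fun x => c • f x) < ⊤ := by
  have h1 : D.modular (fun x => c • f x)
      ≤ ENNReal.ofReal ((max 1 |c|) ^ D.q) * D.modular f := by
    unfold modular
    rw [← lintegral_const_mul' _ _ ENNReal.ofReal_ne_top]
    refine setLIntegral_mono' D.isOpen.measurableSet fun x hx => ?_
    rw [← ENNReal.ofReal_mul (by positivity)]
    refine ENNReal.ofReal_le_ofReal (le_trans (H_mono hx (norm_nonneg _) ?_)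
      (H_mul_le hx (norm_nonneg _) (le_max_left _ _)))
    rw [norm_smul, Real.norm_eq_abs]
    gcongr
    exact le_max_right _ _
  exact h1.trans_lt (ENNReal.mul_lt_top ENNReal.ofReal_lt_top hf)

lemma integrable_of_modular {f : EuclideanSpace ℝ (Fin N) → F}
    (hfm : AEStronglyMeasurable f D.μ) (hf : D.modular f < ⊤) : Integrable f D.μ := by
  have hfin : volume D.Ω < ⊤ := D.isBounded.measure_lt_top
  refine ⟨hfm, ?_⟩
  have h1 : ∫⁻ x in D.Ω, ‖f x‖ₑ ≤ ∫⁻ x in D.Ω, (1 + ENNReal.ofReal (D.H x ‖f x‖)) := by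
    refine setLIntegral_mono' D.isOpen.measurableSet fun x hx => ?_
    rw [← ofReal_norm, ← ENNReal.ofReal_one,
      ← ENNReal.ofReal_add zero_le_one (H_nonneg hx (norm_nonneg _))]
    refine ENNReal.ofReal_le_ofReal ?_
    have hH := H_nonneg hx (norm_nonneg (f x))
    rcases le_total ‖f x‖ 1 with h | h
    · linarith
    · have h2 : ‖f x‖ ≤ ‖f x‖ ^ D.p := by
        simpa using Real.rpow_le_rpow_of_exponent_le h D.one_lt_p.le
      have h3 : 0 ≤ D.a x * ‖f x‖ ^ D.q :=
        mul_nonneg (a_nonneg' hx) (Real.rpow_nonneg (norm_nonneg _) _)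
      unfold H; linarith
  refine h1.trans_lt ?_
  rw [lintegral_add_left measurable_const]
  simp only [lintegral_const, Measure.restrict_apply_univ, one_mul]
  exact ENNReal.add_lt_top.2 ⟨hfin, hf⟩

end Facts

/-! The Musielak-Orlicz space. -/

section Space

variable (F : Type*) [NormedAddCommGroup F] [NormedSpace ℝ F]

/-- Classes of measurable functions on `Ω` (modulo a.e. equality) with finite modular. -/
def lhSubmodule : Submodule ℝ (EuclideanSpace ℝ (Fin N) →ₘ[D.μ] F) where
  carrier := {f | D.modular f < ⊤}
  zero_mem' := by
    have h : ((0 : EuclideanSpace ℝ (Fin N) →ₘ[D.μ] F) : _ → F) =ᵐ[D.μ] fun _ => (0 : F) :=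
      AEEqFun.coeFn_zero
    simp [modular_congr h, modular_zero]
  add_mem' := by
    intro f g hf hg
    have h : ((f + g : EuclideanSpace ℝ (Fin N) →ₘ[D.μ] F) : _ → F) =ᵐ[D.μ]
        fun x => (1 / 2 : ℝ) • ((2 : ℝ) • f x) + (1 / 2 : ℝ) • ((2 : ℝ) • g x) := by
      filter_upwards [AEEqFun.coeFn_add f g] with x hx
      simp [hx, smul_smul]
    have hm : AEStronglyMeasurable (fun x => (2 : ℝ) • f x) D.μ :=
      f.aestronglyMeasurable.const_smul _
    have h1 := modular_convex (D := D) (g := fun x => (2 : ℝ) • g x) hm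
      (b := 1 / 2) (c := 1 / 2) (by norm_num) (by norm_num) (by norm_num)
    change D.modular _ < ⊤
    rw [modular_congr h]
    exact h1.trans_lt (ENNReal.add_lt_top.2
      ⟨ENNReal.mul_lt_top ENNReal.ofReal_lt_top (modular_smul_lt_top hf _),
        ENNReal.mul_lt_top ENNReal.ofReal_lt_top (modular_smul_lt_top hg _)⟩)
  smul_mem' := by
    intro c f hf
    change D.modular _ < ⊤
    rw [modular_congr (AEEqFun.coeFn_smul c f)]
    exact modular_smul_lt_top hf c

/-- The Musielak-Orlicz space `L^H(Ω; F)` (scalar functions: `F = ℝ`; vector fields: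
`F = ℝ^N`, measured through `|f|`). -/
def LH : Type _ := ↥(D.lhSubmodule F)

instance : AddCommGroup (D.LH F) := inferInstanceAs (AddCommGroup ↥(D.lhSubmodule F))
instance : Module ℝ (D.LH F) := inferInstanceAs (Module ℝ ↥(D.lhSubmodule F))

variable {D F}

/-- A representative of an element of `L^H(Ω; F)`. -/
def LH.toFun (f : D.LH F) : EuclideanSpace ℝ (Fin N) → F :=
  ((f : ↥(D.lhSubmodule F)).1 : EuclideanSpace ℝ (Fin N) →ₘ[D.μ] F)

instance : CoeFun (D.LH F) fun _ => EuclideanSpace ℝ (Fin N) → F := ⟨LH.toFun⟩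

/-- The Luxemburg norm `inf {l > 0 : ϱ(f / l) ≤ 1}`. -/
instance : Norm (D.LH F) :=
  ⟨fun f => sInf {l : ℝ | 0 < l ∧ D.modular (fun x => l⁻¹ • f x) ≤ 1}⟩

namespace LH

lemma norm_def (f : D.LH F) :
    ‖f‖ = sInf {l : ℝ | 0 < l ∧ D.modular (fun x => l⁻¹ • f x) ≤ 1} := rfl

lemma aestronglyMeasurable (f : D.LH F) : AEStronglyMeasurable f D.μ :=
  AEEqFun.aestronglyMeasurable _

lemma modular_lt_top (f : D.LH F) : D.modular f < ⊤ :=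
  (f : ↥(D.lhSubmodule F)).2

lemma integrable (f : D.LH F) : Integrable f D.μ :=
  integrable_of_modular f.aestronglyMeasurable f.modular_lt_top

lemma coe_zero : ((0 : D.LH F) : _ → F) =ᵐ[D.μ] fun _ => (0 : F) := AEEqFun.coeFn_zero

lemma coe_add (f g : D.LH F) : ((f + g : D.LH F) : _ → F) =ᵐ[D.μ] fun x => f x + g x :=
  AEEqFun.coeFn_add _ _

lemma coe_smul (c : ℝ) (f : D.LH F) : ((c • f : D.LH F) : _ → F) =ᵐ[D.μ] fun x => c • f x :=
  AEEqFun.coeFn_smul _ _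

lemma ext {f g : D.LH F} (h : (f : _ → F) =ᵐ[D.μ] g) : f = g :=
  Subtype.ext (AEEqFun.ext h)

/-- The unit ball of the modular. -/
def modularBall (D : DoublePhase N) (F : Type*) [NormedAddCommGroup F] [NormedSpace ℝ F] :
    Set (D.LH F) := {f | D.modular f ≤ 1}

lemma norm_eq_gauge (f : D.LH F) : ‖f‖ = gauge (modularBall D F) f := by
  rw [gauge_def', norm_def]
  congr 1
  ext l
  simp only [Set.mem_ofPred_eq, Set.mem_Ioi, modularBall]
  rw [modular_congr (coe_smul l⁻¹ f)]

lemma convex_modularBall : Convex ℝ (modularBall D F) := by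
  intro f hf g hg b c hb hc hbc
  have h : ((b • f + c • g : D.LH F) : _ → F) =ᵐ[D.μ] fun x => b • f x + c • g x := by
    filter_upwards [coe_add (b • f) (c • g), coe_smul b f, coe_smul c g] with x h1 h2 h3
    rw [h1, h2, h3]
  change D.modular _ ≤ 1
  rw [modular_congr h]
  refine (modular_convex f.aestronglyMeasurable hb hc hbc).trans ?_
  calc _ ≤ ENNReal.ofReal b * 1 + ENNReal.ofReal c * 1 := by gcongr <;> assumption
    _ = 1 := by rw [mul_one, mul_one, ← ENNReal.ofReal_add hb hc, hbc, ENNReal.ofReal_one]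

lemma balanced_modularBall : Balanced ℝ (modularBall D F) := by
  rintro c hc _ ⟨f, hf, rfl⟩
  change D.modular _ ≤ 1
  simp only
  rw [modular_congr (coe_smul c f)]
  refine (modular_mono (g := f) fun x => ?_).trans hf
  rw [norm_smul]
  exact mul_le_of_le_one_left (norm_nonneg _) hc

lemma absorbent_modularBall : Absorbent ℝ (modularBall D F) := by
  intro f
  rw [absorbs_iff_eventually_cobounded_mapsTo]
  obtain ⟨M, hM⟩ : ∃ M : ℝ, D.modular f ≤ ENNReal.ofReal M :=
    ⟨(D.modular f).toReal, (ENNReal.ofReal_toReal f.modular_lt_top.ne).ge⟩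
  have h := (tendsto_norm_cobounded_atTop (E := ℝ)).eventually_ge_atTop (max 1 M)
  filter_upwards [h] with c hc
  have hc1 : 1 ≤ ‖c‖ := (le_max_left _ _).trans hc
  have hcM : M ≤ ‖c‖ := (le_max_right _ _).trans hc
  intro g hg
  rw [Set.mem_singleton_iff.1 hg]
  change D.modular _ ≤ 1
  rw [modular_congr (coe_smul c⁻¹ f)]
  refine (modular_mono (g := fun x => ‖c‖⁻¹ • f x) fun x => ?_).trans ?_
  · rw [norm_smul, norm_smul, norm_inv, norm_inv, norm_norm]
  refine (modular_smul_le f.aestronglyMeasurable (by positivity) (inv_le_one_of_one_le₀ hc1)).trans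
    ?_
  calc _ ≤ ENNReal.ofReal ‖c‖⁻¹ * ENNReal.ofReal ‖c‖ := by
        gcongr; exact hM.trans (ENNReal.ofReal_le_ofReal hcM)
    _ = 1 := by
        rw [← ENNReal.ofReal_mul (by positivity), inv_mul_cancel₀ (by linarith),
          ENNReal.ofReal_one]

lemma eq_zero_of_norm (f : D.LH F) (hf : ‖f‖ = 0) : f = 0 := by
  have key : ∀ ε : ℝ, 0 < ε → ε ≤ 1 → D.modular f ≤ ENNReal.ofReal ε := by
    intro ε hε hε1
    rw [norm_eq_gauge] at hf
    obtain ⟨b, hb, hbε, hfb⟩ := exists_lt_of_gauge_lt absorbent_modularBall (hf ▸ hε)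
    obtain ⟨g, hg, rfl⟩ := hfb
    simp only
    rw [modular_congr (coe_smul b g)]
    refine (modular_smul_le g.aestronglyMeasurable hb.le (by linarith)).trans ?_
    calc _ ≤ ENNReal.ofReal b * 1 := by gcongr; exact hg
      _ ≤ _ := by rw [mul_one]; exact ENNReal.ofReal_le_ofReal hbε.le
  have h0 : D.modular f = 0 := by
    refine le_antisymm (ENNReal.le_of_forall_pos_le_add fun ε hε _ => ?_) (zero_le)
    have h1 := key (min (ε : ℝ) 1) (lt_min (by exact_mod_cast hε) one_pos) (min_le_right _ _)
    rw [zero_add]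
    refine h1.trans ((ENNReal.ofReal_le_ofReal (min_le_left _ _)).trans ?_)
    simp
  unfold modular at h0
  rw [lintegral_eq_zero_iff' (aemeasurable_H f.aestronglyMeasurable)] at h0
  refine ext ?_
  filter_upwards [h0, coe_zero (D := D) (F := F), ae_restrict_mem D.isOpen.measurableSet]
    with x hx hz hxΩ
  rw [hz]
  have h2 : D.H x ‖f x‖ ≤ 0 := by simpa using hx
  have h3 : 0 ≤ D.a x * ‖f x‖ ^ D.q :=
    mul_nonneg (a_nonneg' hxΩ) (Real.rpow_nonneg (norm_nonneg _) _)
  by_contra hne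
  have h4 : 0 < ‖f x‖ ^ D.p := Real.rpow_pos_of_pos (norm_pos_iff.2 hne) _
  unfold H at h2
  linarith

lemma normCore : NormedSpace.Core ℝ (D.LH F) where
  norm_nonneg f := by rw [norm_eq_gauge]; exact gauge_nonneg _
  norm_smul c f := by
    rw [norm_eq_gauge, norm_eq_gauge]; exact gauge_smul balanced_modularBall c f
  norm_triangle f g := by
    rw [norm_eq_gauge, norm_eq_gauge, norm_eq_gauge]
    exact gauge_add_le convex_modularBall absorbent_modularBall f g
  norm_eq_zero_iff f := by
    refine ⟨eq_zero_of_norm f, fun h => ?_⟩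
    rw [h, norm_eq_gauge, gauge_zero]

end LH

instance : NormedAddCommGroup (D.LH F) := NormedAddCommGroup.ofCore LH.normCore
instance : NormedSpace ℝ (D.LH F) := NormedSpace.ofCore LH.normCore

end Space

/-! The Musielak-Orlicz-Sobolev spaces. -/

/-- Test functions `C_0^∞(Ω)`. -/
def IsTest (φ : EuclideanSpace ℝ (Fin N) → ℝ) : Prop :=
  ContDiff ℝ ∞ φ ∧ HasCompactSupport φ ∧ tsupport φ ⊆ D.Ω

/-- Pairs of a function and a vector field in `L^H(Ω)`, with norm `‖u‖_H + ‖G‖_H`. -/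
abbrev Pairs : Type := WithLp 1 (D.LH ℝ × D.LH (EuclideanSpace ℝ (Fin N)))

/-- `W^{1,H}(Ω)`, as the space of pairs `(u, ∇u)` of a function in `L^H(Ω)` and its weak gradient,
which also lies in `L^H(Ω)`. The inherited norm is `‖u‖_H + ‖∇u‖_H`. -/
def W1H : Submodule ℝ D.Pairs where
  carrier := {w | ∀ ψ, D.IsTest ψ → ∀ v : EuclideanSpace ℝ (Fin N),
    ∫ x in D.Ω, w.fst x * fderiv ℝ ψ x v = -∫ x in D.Ω, ψ x * inner ℝ (w.snd x) v}
  zero_mem' := by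
    intro ψ _ v
    have h1 : ∫ x in D.Ω, (0 : D.LH ℝ) x * fderiv ℝ ψ x v = 0 := by
      refine integral_eq_zero_of_ae ?_
      filter_upwards [LH.coe_zero (D := D) (F := ℝ)] with x hx
      simp [hx]
    have h2 : ∫ x in D.Ω, ψ x * inner ℝ ((0 : D.LH (EuclideanSpace ℝ (Fin N))) x) v = 0 := by
      refine integral_eq_zero_of_ae ?_
      filter_upwards [LH.coe_zero (D := D) (F := EuclideanSpace ℝ (Fin N))] with x hx
      simp [hx]
    simp only [WithLp.zero_fst, WithLp.zero_snd, h1, h2, neg_zero]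
  add_mem' := by
    intro w z hw hz ψ hψ v
    have hd : Continuous fun x => fderiv ℝ ψ x v :=
      (hψ.1.continuous_fderiv (by simp)).clm_apply continuous_const
    have hds : HasCompactSupport fun x => fderiv ℝ ψ x v := hψ.2.1.fderiv_apply ℝ v
    obtain ⟨C, hC⟩ := hds.exists_bound_of_continuous hd
    obtain ⟨C', hC'⟩ := hψ.2.1.exists_bound_of_continuous hψ.1.continuous
    have i1 : ∀ f : D.LH ℝ, Integrable (fun x => f x * fderiv ℝ ψ x v) D.μ := fun f =>
      f.integrable.mul_bdd (c := C) hd.aestronglyMeasurable (ae_of_all _ hC)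
    have i2 : ∀ f : D.LH (EuclideanSpace ℝ (Fin N)),
        Integrable (fun x => ψ x * inner ℝ (f x) v) D.μ := fun f =>
      (f.integrable.inner_const v).bdd_mul (c := C') hψ.1.continuous.aestronglyMeasurable
        (ae_of_all _ hC')
    have e1 : ∫ x in D.Ω, (w.fst + z.fst) x * fderiv ℝ ψ x v
        = ∫ x in D.Ω, (w.fst x * fderiv ℝ ψ x v + z.fst x * fderiv ℝ ψ x v) := by
      refine integral_congr_ae ?_
      filter_upwards [LH.coe_add w.fst z.fst] with x hx
      rw [hx]; ring
    have e2 : ∫ x in D.Ω, ψ x * inner ℝ ((w.snd + z.snd) x) v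
        = ∫ x in D.Ω, (ψ x * inner ℝ (w.snd x) v + ψ x * inner ℝ (z.snd x) v) := by
      refine integral_congr_ae ?_
      filter_upwards [LH.coe_add w.snd z.snd] with x hx
      rw [hx, inner_add_left]; ring
    rw [WithLp.add_fst, WithLp.add_snd, e1, e2, integral_add (i1 _) (i1 _),
      integral_add (i2 _) (i2 _), hw ψ hψ v, hz ψ hψ v]
    ring
  smul_mem' := by
    intro c w hw ψ hψ v
    have e1 : ∫ x in D.Ω, (c • w.fst) x * fderiv ℝ ψ x v
        = ∫ x in D.Ω, c * (w.fst x * fderiv ℝ ψ x v) := by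
      refine integral_congr_ae ?_
      filter_upwards [LH.coe_smul c w.fst] with x hx
      rw [hx, smul_eq_mul]; ring
    have e2 : ∫ x in D.Ω, ψ x * inner ℝ ((c • w.snd) x) v
        = ∫ x in D.Ω, c * (ψ x * inner ℝ (w.snd x) v) := by
      refine integral_congr_ae ?_
      filter_upwards [LH.coe_smul c w.snd] with x hx
      rw [hx, real_inner_smul_left]; ring
    rw [WithLp.smul_fst, WithLp.smul_snd, e1, e2, integral_const_mul, integral_const_mul,
      hw ψ hψ v]
    ring

instance : NormedAddCommGroup D.W1H := Submodule.normedAddCommGroup D.W1H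
instance : NormedSpace ℝ D.W1H := Submodule.normedSpace D.W1H

/-- The subspace of `W^{1,H}(Ω)` formed by the pairs `(φ, ∇φ)` with `φ ∈ C_0^∞(Ω)`. -/
def testSubmodule : Submodule ℝ D.W1H where
  carrier := {w | ∃ φ, D.IsTest φ ∧ w.1.fst =ᵐ[D.μ] φ ∧ w.1.snd =ᵐ[D.μ] gradient φ}
  zero_mem' := by
    refine ⟨fun _ => 0, ⟨contDiff_const, HasCompactSupport.zero, by simp [tsupport]⟩,
      LH.coe_zero, ?_⟩
    filter_upwards [LH.coe_zero (D := D) (F := EuclideanSpace ℝ (Fin N))] with x hx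
    simpa [gradient] using hx
  add_mem' := by
    rintro w z ⟨φ, hφ, h1, h2⟩ ⟨ψ, hψ, h3, h4⟩
    refine ⟨φ + ψ, ⟨hφ.1.add hψ.1, hφ.2.1.add hψ.2.1,
      (tsupport_add φ ψ).trans (Set.union_subset hφ.2.2 hψ.2.2)⟩, ?_, ?_⟩
    · filter_upwards [LH.coe_add w.1.fst z.1.fst, h1, h3] with x hx e1 e3
      change (w.1.fst + z.1.fst) x = _
      rw [hx, e1, e3, Pi.add_apply]
    · filter_upwards [LH.coe_add w.1.snd z.1.snd, h2, h4] with x hx e2 e4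
      change (w.1.snd + z.1.snd) x = _
      rw [hx, e2, e4]
      unfold gradient
      rw [fderiv_add (hφ.1.differentiable (by simp) x) (hψ.1.differentiable (by simp) x), map_add]
  smul_mem' := by
    rintro c w ⟨φ, hφ, h1, h2⟩
    refine ⟨c • φ, ⟨hφ.1.const_smul c, hφ.2.1.smul_left (f := fun _ => c),
      (tsupport_smul_subset_right (fun _ => c) φ).trans hφ.2.2⟩, ?_, ?_⟩
    · filter_upwards [LH.coe_smul c w.1.fst, h1] with x hx e1
      change (c • w.1.fst) x = _
      rw [hx, e1, Pi.smul_apply]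
    · filter_upwards [LH.coe_smul c w.1.snd, h2] with x hx e2
      change (c • w.1.snd) x = _
      rw [hx, e2]
      unfold gradient
      rw [fderiv_const_smul (hφ.1.differentiable (by simp) x)]
      simp

/-- `W_0^{1,H}(Ω)`: the closure of `C_0^∞(Ω)` in `W^{1,H}(Ω)`. -/
def W0 : Submodule ℝ D.W1H := D.testSubmodule.topologicalClosure

instance : NormedAddCommGroup D.W0 := Submodule.normedAddCommGroup D.W0
instance : NormedSpace ℝ D.W0 := Submodule.normedSpace D.W0

variable {D}

/-- The function underlying an element of `W_0^{1,H}(Ω)`. -/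
def fn (u : D.W0) : EuclideanSpace ℝ (Fin N) → ℝ := u.1.1.fst

/-- The weak gradient of an element of `W_0^{1,H}(Ω)`. -/
def grad (u : D.W0) : EuclideanSpace ℝ (Fin N) → EuclideanSpace ℝ (Fin N) := u.1.1.snd

/-- The double phase density `(|∇u|^(p-2) + a |∇u|^(q-2)) ∇u · ∇v`. -/
def phaseDensity (u v : D.W0) (x : EuclideanSpace ℝ (Fin N)) : ℝ :=
  (‖grad u x‖ ^ (D.p - 2) + D.a x * ‖grad u x‖ ^ (D.q - 2)) * inner ℝ (grad u x) (grad v x)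

/-- The Hardy density `|u|^(p-2) u v / |x|^p + a |u|^(q-2) u v / |x|^q`. -/
def hardyDensity (u v : D.W0) (x : EuclideanSpace ℝ (Fin N)) : ℝ :=
  |fn u x| ^ (D.p - 2) * fn u x / ‖x‖ ^ D.p * fn v x
    + D.a x * (|fn u x| ^ (D.q - 2) * fn u x / ‖x‖ ^ D.q) * fn v x

/-- `L` is the operator `L_γ : W_0^{1,H}(Ω) → (W_0^{1,H}(Ω))^*` given by
`⟨L_γ u, v⟩ = ∫_Ω (|∇u|^(p-2) + a |∇u|^(q-2)) ∇u · ∇v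
    - γ ∫_Ω (|u|^(p-2) u v / |x|^p + a |u|^(q-2) u v / |x|^q)`,
both integrals being absolutely convergent. -/
def IsOperatorL (γ : ℝ) (L : D.W0 → StrongDual ℝ D.W0) : Prop :=
  ∀ u v : D.W0, IntegrableOn (phaseDensity u v) D.Ω ∧ IntegrableOn (hardyDensity u v) D.Ω ∧
    L u v = (∫ x in D.Ω, phaseDensity u v x) - γ * ∫ x in D.Ω, hardyDensity u v x

end DoublePhase

/-- A map `L : X → X^*` is of type (S): if `u_j ⇀ u` weakly and `⟨L u_j - L u, u_j - u⟩ → 0`, then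
`u_j → u` in norm. -/
def IsTypeS {X : Type*} [NormedAddCommGroup X] [NormedSpace ℝ X] (L : X → StrongDual ℝ X) : Prop :=
  ∀ (u : ℕ → X) (u₀ : X), (∀ f : StrongDual ℝ X, Tendsto (fun j => f (u j)) atTop (𝓝 (f u₀))) →
    Tendsto (fun j => (L (u j) - L u₀) (u j - u₀)) atTop (𝓝 0) → Tendsto u atTop (𝓝 u₀)

/-- `κ` is an admissible constant in Simon's inequality in `ℝ^N` with exponent `m ≥ 2`. -/
def IsSimonConstant (N : ℕ) (m κ : ℝ) : Prop :=
  0 < κ ∧ ∀ ξ η : EuclideanSpace ℝ (Fin N),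
    ‖ξ - η‖ ^ m ≤ κ * inner ℝ (‖ξ‖ ^ (m - 2) • ξ - ‖η‖ ^ (m - 2) • η) (ξ - η)

/-- The Hardy constant `H_m = (m / (N - m)) ^ (-m)`. -/
def hardyConstant (N : ℕ) (m : ℝ) : ℝ := (m / ((N : ℝ) - m)) ^ (-m)

end

/-! Put `w_j = u_j - u`, let `ρ_j` be the modular of `∇w_j` and let `h_j` be the integral of `H(x,
|w_j| / |x|)`. Everything reduces to `ρ_j → 0`. Simon's inequality bounds the gradient part of `⟨L
u_j - L u, w_j⟩` below by `ρ_j / max(κ_p, κ_q)` (`integral_H_grad_sub_le`). The Hardy part without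
the factor `γ` equals `h_j + r_j`, and the remainder `r_j` tends to zero by a Brezis-Lieb argument
(`tendsto_integral_hardy_remainder`), which needs bounded `h_j` and a.e. convergence of `u_j`, but
nothing pointwise about gradients. Since `h_j ≤ ρ_j / min(H_p, H_q)` (`lintegral_hardyH_le`), it
follows that `(1 / max κ - max(γ, 0) / min H) ρ_j ≤ ⟨L u_j - L u, w_j⟩ + γ r_j`, and the bound on
`γ` says exactly that the coefficient on the left is positive.

The Hardy inequality must keep its sharp constant in the presence of the weight `a`. A test function
is recovered from its derivative along the outward ray `t x`, `t ≥ 1`, on which `a` does not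
decrease; Hölder with a suitable power of `t`, Tonelli and a dilation then give the constant
(`lintegral_hardy`). Density, Minkowski and Fatou carry it to `W0` (`lintegral_hardy_W0`). As `Ω` is
bounded, it also yields a modular Poincaré inequality, so `ρ_j → 0` forces convergence in norm.

Almost everywhere convergence along subsequences comes from `L^1` convergence
(`tendsto_lintegral_fn_of_weak`), proved directly: averages over balls of radius `r` are continuous
functionals, hence converge, while their `L^1` distance to the function is at most `r` times a
uniform gradient bound. -/

noncomputable section

namespace DoublePhase

variable {N : ℕ} {D : DoublePhase N}

/-! ### Comparison of the Luxemburg norm with the modular and with the `L^1` norm -/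

section LuxemburgNorm

variable {F : Type*} [NormedAddCommGroup F]

lemma modular_const_smul_le [NormedSpace ℝ F] (f : EuclideanSpace ℝ (Fin N) → F) {c : ℝ}
    (hc : 1 ≤ c) :
    D.modular (fun x => c • f x) ≤ ENNReal.ofReal (c ^ D.q) * D.modular f := by
  have hc0 : 0 ≤ c := by linarith
  unfold modular
  rw [← lintegral_const_mul' _ _ ENNReal.ofReal_ne_top]
  refine setLIntegral_mono' D.isOpen.measurableSet fun x hx => ?_
  rw [← ENNReal.ofReal_mul (by positivity), norm_smul, Real.norm_of_nonneg hc0]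
  exact ENNReal.ofReal_le_ofReal (H_mul_le hx (norm_nonneg _) hc)

lemma lintegral_enorm_le_modular (f : EuclideanSpace ℝ (Fin N) → F) :
    ∫⁻ x in D.Ω, ‖f x‖ₑ ≤ volume D.Ω + D.modular f := by
  have h1 : ∫⁻ x in D.Ω, ‖f x‖ₑ ≤ ∫⁻ x in D.Ω, (1 + ENNReal.ofReal (D.H x ‖f x‖)) := by
    refine setLIntegral_mono' D.isOpen.measurableSet fun x hx => ?_
    rw [← ofReal_norm, ← ENNReal.ofReal_one,
      ← ENNReal.ofReal_add zero_le_one (H_nonneg hx (norm_nonneg _))]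
    refine ENNReal.ofReal_le_ofReal ?_
    have hH := H_nonneg hx (norm_nonneg (f x))
    rcases le_total ‖f x‖ 1 with h | h
    · linarith
    · have h2 : ‖f x‖ ≤ ‖f x‖ ^ D.p := by
        simpa using Real.rpow_le_rpow_of_exponent_le h D.one_lt_p.le
      have h3 : 0 ≤ D.a x * ‖f x‖ ^ D.q :=
        mul_nonneg (a_nonneg' hx) (Real.rpow_nonneg (norm_nonneg _) _)
      unfold H; linarith
  refine h1.trans ?_
  rw [lintegral_add_left measurable_const]
  simp [modular]

variable [NormedSpace ℝ F]

namespace LH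

lemma exists_eq_smul_of_norm_lt {f : D.LH F} {r : ℝ} (h : ‖f‖ < r) :
    ∃ b, 0 < b ∧ b < r ∧ ∃ g : D.LH F, D.modular g ≤ 1 ∧ f = b • g := by
  rw [norm_eq_gauge] at h
  obtain ⟨b, hb, hbε, g, hg, rfl⟩ := exists_lt_of_gauge_lt absorbent_modularBall h
  exact ⟨b, hb, hbε, g, hg, rfl⟩

lemma modular_le_of_norm_lt {f : D.LH F} {r : ℝ} (h : ‖f‖ < r) (hr : r ≤ 1) :
    D.modular f ≤ ENNReal.ofReal r := by
  obtain ⟨b, hb, hbr, g, hg, rfl⟩ := exists_eq_smul_of_norm_lt h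
  rw [modular_congr (coe_smul b g)]
  refine (modular_smul_le g.aestronglyMeasurable hb.le (by linarith)).trans ?_
  calc _ ≤ ENNReal.ofReal b * 1 := by gcongr
    _ ≤ _ := by rw [mul_one]; exact ENNReal.ofReal_le_ofReal hbr.le

lemma modular_le_rpow_of_norm_lt {f : D.LH F} {r : ℝ} (h : ‖f‖ < r) (hr : 1 ≤ r) :
    D.modular f ≤ ENNReal.ofReal (r ^ D.q) := by
  obtain ⟨b, hb, hbr, g, hg, rfl⟩ := exists_eq_smul_of_norm_lt h
  rw [modular_congr (coe_smul b g)]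
  calc D.modular (fun x => b • g x) ≤ D.modular (fun x => r • g x) := by
        refine modular_mono fun x => ?_
        rw [norm_smul, norm_smul, Real.norm_of_nonneg hb.le,
          Real.norm_of_nonneg (hb.le.trans hbr.le)]
        gcongr
    _ ≤ ENNReal.ofReal (r ^ D.q) * D.modular g := modular_const_smul_le _ hr
    _ ≤ ENNReal.ofReal (r ^ D.q) * 1 := by gcongr
    _ = _ := mul_one _

/-- Dividing by `r ≤ 1` multiplies the modular by at most `r ^ (-q)`, because the larger exponent
governs scaling up. This gives the nontrivial half of the equivalence between modular and norm
convergence to zero. -/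
lemma norm_le_of_modular_le {f : D.LH F} {r : ℝ} (hr : 0 < r) (hr1 : r ≤ 1)
    (h : D.modular f ≤ ENNReal.ofReal (r ^ D.q)) : ‖f‖ ≤ r := by
  rw [norm_def]
  refine csInf_le ⟨0, fun l hl => hl.1.le⟩ ⟨hr, ?_⟩
  refine (modular_const_smul_le _ (one_le_inv_iff₀.2 ⟨hr, hr1⟩)).trans ?_
  calc _ ≤ ENNReal.ofReal (r⁻¹ ^ D.q) * ENNReal.ofReal (r ^ D.q) := by gcongr
    _ = 1 := by
      rw [← ENNReal.ofReal_mul (by positivity), ← Real.mul_rpow (by positivity) hr.le,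
        inv_mul_cancel₀ hr.ne', Real.one_rpow, ENNReal.ofReal_one]

lemma tendsto_norm_zero_of_modular {ι : Type*} {l : Filter ι} {f : ι → D.LH F}
    (h : Tendsto (fun j => D.modular (f j)) l (𝓝 0)) : Tendsto (fun j => ‖f j‖) l (𝓝 0) := by
  rw [Metric.tendsto_nhds]
  intro ε hε
  have hr : 0 < min (ε / 2) 1 := by positivity
  have h0 : (0 : ℝ≥0∞) < ENNReal.ofReal ((min (ε / 2) 1) ^ D.q) :=
    ENNReal.ofReal_pos.2 (by positivity)
  filter_upwards [h.eventually_lt_const h0] with j hj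
  have h1 := norm_le_of_modular_le hr (min_le_right _ _) hj.le
  rw [Real.dist_0_eq_abs, abs_of_nonneg (norm_nonneg _)]
  linarith [min_le_left (ε / 2) 1]

lemma tendsto_modular_zero_of_norm {ι : Type*} {l : Filter ι} {f : ι → D.LH F}
    (h : Tendsto (fun j => ‖f j‖) l (𝓝 0)) : Tendsto (fun j => D.modular (f j)) l (𝓝 0) := by
  have h1 : Tendsto (fun r : ℝ => ENNReal.ofReal r) (𝓝[>] 0) (𝓝 0) := by
    simpa using (ENNReal.continuous_ofReal.tendsto 0).mono_left nhdsWithin_le_nhds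
  rw [ENNReal.tendsto_nhds_zero]
  intro ε hε
  have h2 : ∀ᶠ r : ℝ in 𝓝[>] 0, ENNReal.ofReal r ≤ ε ∧ r ≤ 1 ∧ 0 < r :=
    ((h1.eventually_le_const hε).and
      ((eventually_le_nhds one_pos).filter_mono nhdsWithin_le_nhds)).and self_mem_nhdsWithin
      |>.mono fun r hr => ⟨hr.1.1, hr.1.2, hr.2⟩
  obtain ⟨r, hrε, hr1, hr0⟩ := h2.exists
  filter_upwards [h.eventually_lt_const hr0] with j hj
  exact (modular_le_of_norm_lt hj hr1).trans hrε

/-- Since `t ≤ 1 + H(x, t)`, the `L^1` norm is at most `|Ω| + 1` on the unit ball of the modular;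
homogeneity does the rest. -/
lemma lintegral_enorm_le (f : D.LH F) :
    ∫⁻ x in D.Ω, ‖f x‖ₑ ≤ (volume D.Ω + 1) * ENNReal.ofReal ‖f‖ := by
  have hfin : volume D.Ω + 1 ≠ ⊤ :=
    ENNReal.add_ne_top.2 ⟨D.isBounded.measure_lt_top.ne, ENNReal.one_ne_top⟩
  have h1 : ∀ r, ‖f‖ < r → ∫⁻ x in D.Ω, ‖f x‖ₑ ≤ (volume D.Ω + 1) * ENNReal.ofReal r := by
    intro r hr
    obtain ⟨b, hb, hbr, g, hg, rfl⟩ := exists_eq_smul_of_norm_lt hr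
    calc ∫⁻ x in D.Ω, ‖(b • g : D.LH F) x‖ₑ = ∫⁻ x in D.Ω, ENNReal.ofReal b * ‖g x‖ₑ := by
          refine lintegral_congr_ae ?_
          filter_upwards [coe_smul b g] with x hx
          rw [hx, enorm_smul, Real.enorm_of_nonneg hb.le]
      _ = ENNReal.ofReal b * ∫⁻ x in D.Ω, ‖g x‖ₑ :=
          lintegral_const_mul' _ _ ENNReal.ofReal_ne_top
      _ ≤ ENNReal.ofReal r * (volume D.Ω + 1) := by
          gcongr
          exact (lintegral_enorm_le_modular _).trans (by gcongr)
      _ = _ := mul_comm _ _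
  -- The gauge only provides a scaling below each `r > ‖f‖`, so the bound at `‖f‖` itself is reached
  -- as `r` decreases.
  have h2 : Tendsto (fun r : ℝ => (volume D.Ω + 1) * ENNReal.ofReal r) (𝓝[>] ‖f‖)
      (𝓝 ((volume D.Ω + 1) * ENNReal.ofReal ‖f‖)) :=
    ENNReal.Tendsto.const_mul ((ENNReal.continuous_ofReal.tendsto _).mono_left
      nhdsWithin_le_nhds) (Or.inr hfin)
  exact ge_of_tendsto h2 (by filter_upwards [self_mem_nhdsWithin] with r hr using h1 r hr)

end LH

end LuxemburgNorm

/-! ### Pointwise representatives and approximation by test functions -/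

section Representatives

lemma fn_add (u v : D.W0) : fn (u + v) =ᵐ[D.μ] fun x => fn u x + fn v x :=
  LH.coe_add u.1.1.fst v.1.1.fst

lemma fn_smul (c : ℝ) (u : D.W0) : fn (c • u) =ᵐ[D.μ] fun x => c * fn u x :=
  LH.coe_smul c u.1.1.fst

lemma grad_add (u v : D.W0) : grad (u + v) =ᵐ[D.μ] fun x => grad u x + grad v x :=
  LH.coe_add u.1.1.snd v.1.1.snd

lemma grad_smul (c : ℝ) (u : D.W0) : grad (c • u) =ᵐ[D.μ] fun x => c • grad u x :=
  LH.coe_smul c u.1.1.snd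

lemma fn_sub (u v : D.W0) : fn (u - v) =ᵐ[D.μ] fun x => fn u x - fn v x := by
  rw [show u - v = u + (-1 : ℝ) • v by rw [neg_one_smul, sub_eq_add_neg]]
  filter_upwards [fn_add u ((-1 : ℝ) • v), fn_smul (-1) v] with x h1 h2
  rw [h1, h2]; ring

lemma grad_sub (u v : D.W0) : grad (u - v) =ᵐ[D.μ] fun x => grad u x - grad v x := by
  rw [show u - v = u + (-1 : ℝ) • v by rw [neg_one_smul, sub_eq_add_neg]]
  filter_upwards [grad_add u ((-1 : ℝ) • v), grad_smul (-1) v] with x h1 h2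
  rw [h1, h2, neg_one_smul, sub_eq_add_neg]

lemma aestronglyMeasurable_fn (u : D.W0) : AEStronglyMeasurable (fn u) D.μ :=
  LH.aestronglyMeasurable _

lemma aestronglyMeasurable_grad (u : D.W0) : AEStronglyMeasurable (grad u) D.μ :=
  LH.aestronglyMeasurable _

lemma norm_W0 (u : D.W0) : ‖u‖ = ‖u.1.1.fst‖ + ‖u.1.1.snd‖ :=
  WithLp.prod_norm_eq_of_L1 u.1.1

lemma norm_fst_le (u : D.W0) : ‖u.1.1.fst‖ ≤ ‖u‖ := by
  rw [norm_W0]; linarith [norm_nonneg u.1.1.snd]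

lemma norm_snd_le (u : D.W0) : ‖u.1.1.snd‖ ≤ ‖u‖ := by
  rw [norm_W0]; linarith [norm_nonneg u.1.1.fst]

lemma lintegral_fn_le (u : D.W0) :
    ∫⁻ x in D.Ω, ‖fn u x‖ₑ ≤ (volume D.Ω + 1) * ENNReal.ofReal ‖u‖ :=
  (LH.lintegral_enorm_le u.1.1.fst).trans (by gcongr; exact norm_fst_le u)

lemma lintegral_grad_le (u : D.W0) :
    ∫⁻ x in D.Ω, ‖grad u x‖ₑ ≤ (volume D.Ω + 1) * ENNReal.ofReal ‖u‖ :=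
  (LH.lintegral_enorm_le u.1.1.snd).trans (by gcongr; exact norm_snd_le u)

/-- Elements of `W_0^{1,H}(Ω)` represented by a test function. -/
def IsTestElement (u : D.W0) (φ : EuclideanSpace ℝ (Fin N) → ℝ) : Prop :=
  D.IsTest φ ∧ fn u =ᵐ[D.μ] φ ∧ grad u =ᵐ[D.μ] gradient φ

lemma exists_isTestElement_norm_sub_lt (u : D.W0) {ε : ℝ} (hε : 0 < ε) :
    ∃ (v : D.W0) (φ : EuclideanSpace ℝ (Fin N) → ℝ), IsTestElement v φ ∧ ‖v - u‖ < ε := by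
  have hu : (u : D.W1H) ∈ closure (D.testSubmodule : Set D.W1H) := u.2
  obtain ⟨b, ⟨φ, hφ⟩, hb⟩ := Metric.mem_closure_iff.1 hu ε hε
  refine ⟨⟨b, subset_closure ⟨φ, hφ⟩⟩, φ, hφ, ?_⟩
  rw [dist_comm, dist_eq_norm] at hb
  exact hb

end Representatives

end DoublePhase

/-! ### Weighted Hardy inequality for test functions -/

section Hardy

variable {E : Type*} [NormedAddCommGroup E] [NormedSpace ℝ E]

/-- This is the fundamental theorem of calculus on the ray from `x` to infinity. Compact support
removes the far endpoint; `x ≠ 0` makes the ray a closed embedding, so that support is inherited.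
Integrating outward is what later matches the monotonicity of the weight. -/
lemma enorm_le_lintegral_ray {φ : E → ℝ} (hφ : ContDiff ℝ 1 φ) (hc : HasCompactSupport φ)
    {x : E} (hx : x ≠ 0) :
    ‖φ x‖ₑ ≤ ‖x‖ₑ * ∫⁻ t in Set.Ioi (1 : ℝ), ‖fderiv ℝ φ (t • x)‖ₑ := by
  have hf : ContDiff ℝ 1 fun t : ℝ => φ (t • x) := hφ.comp (contDiff_id.smul contDiff_const)
  have hcf : HasCompactSupport fun t : ℝ => φ (t • x) :=
    hc.comp_isClosedEmbedding (isClosedEmbedding_smul_left hx)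
  have hd : ∀ t : ℝ, deriv (fun t : ℝ => φ (t • x)) t = fderiv ℝ φ (t • x) x := fun t => by
    have h1 : HasDerivAt (fun t : ℝ => t • x) x t := by
      simpa using (hasDerivAt_id t).smul_const x
    exact ((hφ.differentiable one_ne_zero _).hasFDerivAt.comp_hasDerivAt t h1).deriv
  have h := HasCompactSupport.integral_Ioi_deriv_eq hf hcf 1
  simp only [one_smul] at h
  rw [← enorm_neg, ← h]
  refine (enorm_integral_le_lintegral_enorm _).trans ?_
  rw [← lintegral_const_mul' _ _ enorm_ne_top]
  refine lintegral_mono fun t => ?_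
  rw [hd, mul_comm]
  exact (fderiv ℝ φ (t • x)).le_opENorm x

lemma lintegral_Ioi_one_rpow {s : ℝ} (hs : 1 < s) :
    ∫⁻ t in Set.Ioi (1 : ℝ), ENNReal.ofReal (t ^ (-s)) = ENNReal.ofReal (s - 1)⁻¹ := by
  rw [← ofReal_integral_eq_lintegral_ofReal
    (integrableOn_Ioi_rpow_of_lt (by linarith) one_pos)
    ((ae_restrict_mem measurableSet_Ioi).mono fun t ht =>
      Real.rpow_nonneg (zero_le_one.trans (le_of_lt ht)) _),
    integral_Ioi_rpow_of_lt (by linarith) one_pos, Real.one_rpow]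
  congr 1
  rw [show -s + 1 = -(s - 1) by ring, neg_div_neg_eq, one_div]

/-- Hölder's inequality on the half-line with the weights that are optimal for Hardy's
inequality. -/
lemma rpow_lintegral_Ioi_one_le {G : ℝ → ℝ≥0∞} (hG : Measurable G) {m n : ℝ} (hm : 1 < m)
    (hmn : m < n) :
    (∫⁻ t in Set.Ioi (1 : ℝ), G t) ^ m ≤ ENNReal.ofReal (m / (n - m)) ^ (m - 1) *
      ∫⁻ t in Set.Ioi (1 : ℝ), G t ^ m * ENNReal.ofReal (t ^ (n - n / m)) := by
  have hm0 : 0 < m := by linarith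
  have hm1 : 0 < m - 1 := by linarith
  -- With this exponent the dual weight becomes `t ^ (-n / m)`, integrable at infinity as `m < n`.
  -- The other weight `t ^ (n - n / m)` also becomes `t ^ (-n / m)` once a dilation in `x` supplies
  -- `t ^ (-n)`, so both factors produce the same number `m / (n - m)`.
  set α : ℝ := (n - n / m) / m with hα
  have hc : m.HolderConjugate m.conjExponent := Real.HolderConjugate.conjExponent hm
  have hc' : α * m.conjExponent = n / m := by
    rw [hα, Real.conjExponent]; field_simp
  have h1 : ∫⁻ t in Set.Ioi (1 : ℝ), G t = ∫⁻ t in Set.Ioi (1 : ℝ),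
      ((fun t => G t * ENNReal.ofReal (t ^ α)) * fun t => ENNReal.ofReal (t ^ (-α))) t := by
    refine setLIntegral_congr_fun measurableSet_Ioi fun t ht => ?_
    have ht0 : 0 < t := zero_lt_one.trans ht
    simp only [Pi.mul_apply]
    rw [mul_assoc, ← ENNReal.ofReal_mul (by positivity), ← Real.rpow_add ht0]
    simp
  have h2 := ENNReal.lintegral_mul_le_Lp_mul_Lq (volume.restrict (Set.Ioi (1 : ℝ))) hc
    (f := fun t => G t * ENNReal.ofReal (t ^ α)) (g := fun t => ENNReal.ofReal (t ^ (-α)))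
    (by fun_prop) (by fun_prop)
  have h3 : ∫⁻ t in Set.Ioi (1 : ℝ), (G t * ENNReal.ofReal (t ^ α)) ^ m =
      ∫⁻ t in Set.Ioi (1 : ℝ), G t ^ m * ENNReal.ofReal (t ^ (n - n / m)) := by
    refine setLIntegral_congr_fun measurableSet_Ioi fun t ht => ?_
    have ht0 : 0 < t := zero_lt_one.trans ht
    rw [ENNReal.mul_rpow_of_nonneg _ _ hm0.le,
      ENNReal.ofReal_rpow_of_nonneg (by positivity) hm0.le, ← Real.rpow_mul ht0.le, hα,
      div_mul_cancel₀ _ hm0.ne']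
  have h4 : ∫⁻ t in Set.Ioi (1 : ℝ), ENNReal.ofReal (t ^ (-α)) ^ m.conjExponent =
      ENNReal.ofReal (m / (n - m)) := by
    rw [show m / (n - m) = (n / m - 1)⁻¹ by
      rw [div_sub_one hm0.ne', inv_div], ← lintegral_Ioi_one_rpow ((one_lt_div hm0).2 hmn)]
    refine setLIntegral_congr_fun measurableSet_Ioi fun t ht => ?_
    have ht0 : 0 < t := zero_lt_one.trans ht
    rw [ENNReal.ofReal_rpow_of_nonneg (by positivity) hc.symm.nonneg, ← Real.rpow_mul ht0.le,
      neg_mul, hc']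
  rw [h3, h4] at h2
  rw [h1]
  refine (ENNReal.rpow_le_rpow h2 hm0.le).trans (le_of_eq ?_)
  rw [ENNReal.mul_rpow_of_nonneg _ _ hm0.le, ← ENNReal.rpow_mul, ← ENNReal.rpow_mul,
    one_div_mul_cancel hm0.ne', ENNReal.rpow_one, mul_comm]
  congr 2
  rw [Real.conjExponent]; field_simp

variable [MeasurableSpace E] [BorelSpace E] [FiniteDimensional ℝ E] (ν : Measure E)
  [ν.IsAddHaarMeasure]

lemma lintegral_comp_smul_of_pos {g : E → ℝ≥0∞} (hg : Measurable g) {t : ℝ} (ht : 0 < t) :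
    ∫⁻ x, g (t • x) ∂ν =
      ENNReal.ofReal (t ^ (-(Module.finrank ℝ E : ℝ))) * ∫⁻ x, g x ∂ν := by
  rw [← lintegral_map hg (measurable_const_smul t), Measure.map_addHaar_smul ν ht.ne',
    lintegral_smul_measure, abs_of_pos (by positivity), Real.rpow_neg ht.le, Real.rpow_natCast,
    smul_eq_mul]

/-- Hardy's inequality with sharp constant and a weight that increases along rays. -/
theorem lintegral_hardy {S : Set E} (hS : MeasurableSet S) {w : E → ℝ≥0∞} (hw : Measurable w)
    (hmono : ∀ x ∈ S, ∀ t : ℝ, 1 ≤ t → t • x ∈ S → w x ≤ w (t • x)) {φ : E → ℝ}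
    (hφ : ContDiff ℝ 1 φ) (hc : HasCompactSupport φ) (hsupp : tsupport φ ⊆ S) {m : ℝ}
    (hm : 1 < m) (hmn : m < Module.finrank ℝ E) :
    ∫⁻ x in S, w x * (‖φ x‖ₑ / ‖x‖ₑ) ^ m ∂ν ≤
      ENNReal.ofReal ((m / (Module.finrank ℝ E - m)) ^ m) *
        ∫⁻ x in S, w x * ‖fderiv ℝ φ x‖ₑ ^ m ∂ν := by
  set n : ℝ := (Module.finrank ℝ E : ℝ) with hn
  have hm0 : 0 < m := by linarith
  have hK : 0 < m / (n - m) := div_pos hm0 (by linarith)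
  have : Nontrivial E := by
    refine Module.nontrivial_of_finrank_pos (R := ℝ) ?_
    have : (0 : ℝ) < Module.finrank ℝ E := by linarith
    exact_mod_cast this
  have hfd : Measurable fun x => ‖fderiv ℝ φ x‖ₑ :=
    (hφ.continuous_fderiv one_ne_zero).enorm.measurable
  set g : E → ℝ≥0∞ := S.indicator fun x => w x * ‖fderiv ℝ φ x‖ₑ ^ m with hgdef
  have hg : Measurable g := (hw.mul (hfd.pow_const m)).indicator hS
  have hzero : ∀ x ∉ S, fderiv ℝ φ x = 0 := fun x hx => by
    by_contra h
    exact hx (hsupp (support_fderiv_subset ℝ h))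
  have hpt : ∀ x ∈ S, x ≠ 0 → w x * (‖φ x‖ₑ / ‖x‖ₑ) ^ m ≤ ENNReal.ofReal (m / (n - m)) ^ (m - 1) *
      ∫⁻ t in Set.Ioi (1 : ℝ), g (t • x) * ENNReal.ofReal (t ^ (n - n / m)) := by
    intro x hxS hx
    have h1 : ‖φ x‖ₑ / ‖x‖ₑ ≤ ∫⁻ t in Set.Ioi (1 : ℝ), ‖fderiv ℝ φ (t • x)‖ₑ :=
      ENNReal.div_le_of_le_mul' (enorm_le_lintegral_ray hφ hc hx)
    have hfx : Measurable fun t : ℝ => ‖fderiv ℝ φ (t • x)‖ₑ :=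
      hfd.comp (measurable_id.smul_const x)
    have h2 := (ENNReal.rpow_le_rpow h1 hm0.le).trans (rpow_lintegral_Ioi_one_le hfx hm hmn)
    refine (mul_le_mul_right h2 _).trans ?_
    rw [mul_left_comm]
    refine mul_le_mul_right ?_ _
    rw [← lintegral_const_mul _ (by fun_prop)]
    refine setLIntegral_mono' measurableSet_Ioi fun t ht => ?_
    rw [← mul_assoc]
    gcongr ?_ * _
    -- The ray may leave `S` and come back, since `S` need not be star-shaped. Outside `S` the
    -- derivative vanishes, so the weight is compared only at points of `S`.
    by_cases htx : t • x ∈ S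
    · rw [hgdef, Set.indicator_of_mem htx]
      gcongr
      exact hmono x hxS t (le_of_lt ht) htx
    · rw [← ofReal_norm, hzero _ htx, norm_zero, ENNReal.ofReal_zero,
        ENNReal.zero_rpow_of_pos hm0, mul_zero]
      exact zero_le
  calc ∫⁻ x in S, w x * (‖φ x‖ₑ / ‖x‖ₑ) ^ m ∂ν
      ≤ ∫⁻ x in S, ENNReal.ofReal (m / (n - m)) ^ (m - 1) *
        (∫⁻ t in Set.Ioi (1 : ℝ), g (t • x) * ENNReal.ofReal (t ^ (n - n / m))) ∂ν := by
        refine lintegral_mono_ae ?_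
        have h0 : ∀ᵐ x ∂ν, x ≠ 0 := by simp [ae_iff]
        filter_upwards [ae_restrict_mem hS, ae_restrict_of_ae h0] with x h1 h2 using hpt x h1 h2
    _ ≤ ∫⁻ x, ENNReal.ofReal (m / (n - m)) ^ (m - 1) *
        (∫⁻ t in Set.Ioi (1 : ℝ), g (t • x) * ENNReal.ofReal (t ^ (n - n / m))) ∂ν :=
        setLIntegral_le_lintegral _ _
    _ = ENNReal.ofReal (m / (n - m)) ^ (m - 1) *
        ∫⁻ t in Set.Ioi (1 : ℝ), ∫⁻ x, g (t • x) * ENNReal.ofReal (t ^ (n - n / m)) ∂ν := by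
        have hmeas : Measurable fun z : E × ℝ =>
            g (z.2 • z.1) * ENNReal.ofReal (z.2 ^ (n - n / m)) :=
          (hg.comp (measurable_snd.smul measurable_fst)).mul (by fun_prop)
        rw [lintegral_const_mul _ hmeas.lintegral_prod_right',
          lintegral_lintegral_swap hmeas.aemeasurable]
    -- The dilation by `t` contributes `t ^ (-n)`, which leaves `t ^ (-(n / m))`; its integral is
    -- the last missing factor `m / (n - m)`.
    _ = ENNReal.ofReal (m / (n - m)) ^ (m - 1) *
        ∫⁻ t in Set.Ioi (1 : ℝ), ENNReal.ofReal (t ^ (-(n / m))) * ∫⁻ x, g x ∂ν := by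
        congr 1
        refine setLIntegral_congr_fun measurableSet_Ioi fun t ht => ?_
        have ht0 : 0 < t := zero_lt_one.trans ht
        have hgt : Measurable fun x => g (t • x) := hg.comp (measurable_const_smul t)
        rw [lintegral_mul_const _ hgt,
          lintegral_comp_smul_of_pos ν hg ht0, mul_right_comm, ← ENNReal.ofReal_mul (by positivity),
          ← Real.rpow_add ht0]
        congr 3
        ring
    _ = ENNReal.ofReal ((m / (n - m)) ^ m) * ∫⁻ x, g x ∂ν := by
        rw [lintegral_mul_const _ (by fun_prop), lintegral_Ioi_one_rpow ((one_lt_div hm0).2 hmn),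
          show (n / m - 1)⁻¹ = m / (n - m) by rw [div_sub_one hm0.ne', inv_div], ← mul_assoc,
          ENNReal.ofReal_rpow_of_pos hK, ← ENNReal.ofReal_mul (by positivity),
          Real.rpow_sub_one hK.ne', div_mul_cancel₀ _ hK.ne']
    _ = _ := by rw [hgdef, lintegral_indicator hS]

end Hardy

namespace DoublePhase

variable {N : ℕ} {D : DoublePhase N}

/-! ### Hardy inequality in `W0` and for the double phase modular -/

section HardyW0

lemma exists_subseq_tendsto_fn {v : ℕ → D.W0} {u : D.W0}
    (h : Tendsto (fun k => ∫⁻ x in D.Ω, ‖fn (v k - u) x‖ₑ) atTop (𝓝 0)) :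
    ∃ ns : ℕ → ℕ, StrictMono ns ∧
      ∀ᵐ x ∂D.μ, Tendsto (fun k => fn (v (ns k)) x) atTop (𝓝 (fn u x)) := by
  have hm : TendstoInMeasure D.μ (fun k => fn (v k)) atTop (fn u) := by
    refine tendstoInMeasure_of_tendsto_eLpNorm (p := 1) one_ne_zero
      (fun k => aestronglyMeasurable_fn (v k)) (aestronglyMeasurable_fn u) ?_
    refine h.congr fun k => ?_
    rw [eLpNorm_one_eq_lintegral_enorm]
    refine lintegral_congr_ae ?_
    filter_upwards [fn_sub (v k) u] with x hx
    rw [hx, Pi.sub_apply]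
  exact hm.exists_seq_tendsto_ae

lemma tendsto_lintegral_fn_of_norm {v : ℕ → D.W0} {u : D.W0}
    (h : Tendsto (fun k => ‖v k - u‖) atTop (𝓝 0)) :
    Tendsto (fun k => ∫⁻ x in D.Ω, ‖fn (v k - u) x‖ₑ) atTop (𝓝 0) := by
  have hfin : volume D.Ω + 1 ≠ ⊤ :=
    ENNReal.add_ne_top.2 ⟨D.isBounded.measure_lt_top.ne, ENNReal.one_ne_top⟩
  have h1 : Tendsto (fun k => (volume D.Ω + 1) * ENNReal.ofReal ‖v k - u‖) atTop (𝓝 0) := by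
    have := ENNReal.Tendsto.const_mul (ENNReal.tendsto_ofReal h)
      (a := volume D.Ω + 1) (Or.inr hfin)
    rwa [ENNReal.ofReal_zero, mul_zero] at this
  exact tendsto_of_tendsto_of_tendsto_of_le_of_le tendsto_const_nhds h1 (fun _ => zero_le)
    fun k => lintegral_fn_le _

lemma lintegral_hardy_of_isTestElement {w : EuclideanSpace ℝ (Fin N) → ℝ≥0∞} (hw : Measurable w)
    (hmono : ∀ x ∈ D.Ω, ∀ t : ℝ, 1 ≤ t → t • x ∈ D.Ω → w x ≤ w (t • x)) {m : ℝ} (hm : 1 < m)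
    (hmN : m < N) {v : D.W0} {φ : EuclideanSpace ℝ (Fin N) → ℝ} (hv : IsTestElement v φ) :
    ∫⁻ x in D.Ω, w x * (‖fn v x‖ₑ / ‖x‖ₑ) ^ m ≤
      ENNReal.ofReal ((m / (N - m)) ^ m) * ∫⁻ x in D.Ω, w x * ‖grad v x‖ₑ ^ m := by
  obtain ⟨⟨hφ, hc, hs⟩, h1, h2⟩ := hv
  have h := lintegral_hardy volume D.isOpen.measurableSet hw hmono (hφ.of_le (by simp)) hc hs hm
    (by simpa using hmN)
  rw [finrank_euclideanSpace_fin] at h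
  convert! h using 1
  · refine lintegral_congr_ae ?_
    filter_upwards [h1] with x hx
    rw [hx]
  · congr 1
    refine lintegral_congr_ae ?_
    filter_upwards [h2] with x hx
    rw [hx, gradient, ← ofReal_norm, LinearIsometryEquiv.norm_map, ofReal_norm]

/-- Hardy's inequality in `W_0^{1,H}(Ω)`. -/
lemma lintegral_hardy_W0 {w : EuclideanSpace ℝ (Fin N) → ℝ≥0∞} (hw : Measurable w)
    (hmono : ∀ x ∈ D.Ω, ∀ t : ℝ, 1 ≤ t → t • x ∈ D.Ω → w x ≤ w (t • x)) {m : ℝ} (hm : 1 < m)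
    (hmN : m < N) (hH : ∀ x ∈ D.Ω, ∀ s : ℝ, 0 ≤ s →
      w x * ENNReal.ofReal s ^ m ≤ ENNReal.ofReal (D.H x s)) (u : D.W0) :
    ∫⁻ x in D.Ω, w x * (‖fn u x‖ₑ / ‖x‖ₑ) ^ m ≤
      ENNReal.ofReal ((m / (N - m)) ^ m) * ∫⁻ x in D.Ω, w x * ‖grad u x‖ₑ ^ m := by
  have hm0 : 0 < m := by linarith
  have hwtop : ∀ x ∈ D.Ω, w x ≠ ⊤ := fun x hx => by
    have := hH x hx 1 zero_le_one
    rw [ENNReal.ofReal_one, ENNReal.one_rpow, mul_one] at this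
    exact (this.trans_lt ENNReal.ofReal_lt_top).ne
  choose v φ hvφ hvu using fun k : ℕ =>
    exists_isTestElement_norm_sub_lt u (Nat.one_div_pos_of_nat (α := ℝ) (n := k))
  have hlim : Tendsto (fun k => ‖v k - u‖) atTop (𝓝 0) :=
    squeeze_zero (fun _ => norm_nonneg _) (fun k => (hvu k).le)
      tendsto_one_div_add_atTop_nhds_zero_nat
  obtain ⟨ns, hns, hae⟩ := exists_subseq_tendsto_fn (tendsto_lintegral_fn_of_norm hlim)
  -- `I` is a weighted `L^m` seminorm of the gradient: `hH` bounds it by the modular, hence it is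
  -- small on elements of small norm, and Minkowski makes it subadditive.
  set I : D.W0 → ℝ≥0∞ := fun u => (∫⁻ x in D.Ω, w x * ‖grad u x‖ₑ ^ m) ^ (1 / m) with hI
  have hIpow : ∀ u, I u ^ m = ∫⁻ x in D.Ω, w x * ‖grad u x‖ₑ ^ m := fun u => by
    rw [hI, ← ENNReal.rpow_mul, one_div_mul_cancel hm0.ne', ENNReal.rpow_one]
  have hIle : ∀ v : D.W0, I v ≤ (D.modular (grad v)) ^ (1 / m) := fun v => by
    refine ENNReal.rpow_le_rpow (setLIntegral_mono' D.isOpen.measurableSet fun x hx => ?_)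
      (by positivity)
    rw [← ofReal_norm]
    exact hH x hx _ (norm_nonneg _)
  have hadd : ∀ v : D.W0, I v ≤ I u + I (v - u) := fun v => by
    have h := ENNReal.lintegral_Lp_add_le (μ := D.μ) (p := m)
      (f := fun x => w x ^ (1 / m) * ‖grad u x‖ₑ) (g := fun x => w x ^ (1 / m) * ‖grad (v - u) x‖ₑ)
      ((hw.pow_const _).aemeasurable.mul (aestronglyMeasurable_grad u).enorm)
      ((hw.pow_const _).aemeasurable.mul (aestronglyMeasurable_grad _).enorm) hm.le
    have e : ∀ (a b : ℝ≥0∞), (a ^ (1 / m) * b) ^ m = a * b ^ m := fun a b => by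
      rw [ENNReal.mul_rpow_of_nonneg _ _ hm0.le, ← ENNReal.rpow_mul, one_div_mul_cancel hm0.ne',
        ENNReal.rpow_one]
    simp only [Pi.add_apply, ← mul_add, e] at h
    refine le_trans (ENNReal.rpow_le_rpow (lintegral_mono_ae ?_) (by positivity)) h
    filter_upwards [grad_sub v u] with x hx
    gcongr
    rw [hx]
    refine le_trans (le_of_eq ?_) (enorm_add_le _ _)
    rw [add_sub_cancel]
  have hItend : Tendsto (fun k => I (v (ns k) - u)) atTop (𝓝 0) := by
    have h1 : Tendsto (fun k => D.modular (grad (v (ns k) - u))) atTop (𝓝 0) :=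
      LH.tendsto_modular_zero_of_norm (squeeze_zero (fun _ => norm_nonneg _)
        (fun k => norm_snd_le (v (ns k) - u)) (hlim.comp hns.tendsto_atTop))
    have h2 := (ENNReal.continuous_rpow_const (y := 1 / m)).tendsto 0 |>.comp h1
    rw [ENNReal.zero_rpow_of_pos (by positivity)] at h2
    exact tendsto_of_tendsto_of_tendsto_of_le_of_le tendsto_const_nhds h2 (fun _ => zero_le)
      fun k => hIle _
  have hK : ENNReal.ofReal ((m / (N - m)) ^ m) ≠ ⊤ := ENNReal.ofReal_ne_top
  have hR : Tendsto (fun k => ENNReal.ofReal ((m / (N - m)) ^ m) * (I u + I (v (ns k) - u)) ^ m)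
      atTop (𝓝 (ENNReal.ofReal ((m / (N - m)) ^ m) * (I u) ^ m)) := by
    refine ENNReal.Tendsto.const_mul ?_ (Or.inr hK)
    have h2 := (ENNReal.continuous_rpow_const (y := m)).tendsto (I u + 0) |>.comp
      (tendsto_const_nhds.add hItend)
    rwa [add_zero] at h2
  rw [← hIpow u]
  -- Fatou handles the left side along an a.e. convergent subsequence of test functions, so no prior
  -- integrability of the Hardy term is needed; the right side converges through `I`.
  calc ∫⁻ x in D.Ω, w x * (‖fn u x‖ₑ / ‖x‖ₑ) ^ m
      ≤ ∫⁻ x in D.Ω, liminf (fun k => w x * (‖fn (v (ns k)) x‖ₑ / ‖x‖ₑ) ^ m) atTop := by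
        refine lintegral_mono_ae ?_
        have : NeZero N := ⟨by have := D.two_le_dim; omega⟩
        have h0 : ∀ᵐ x : EuclideanSpace ℝ (Fin N), x ≠ 0 := by simp [ae_iff]
        filter_upwards [hae, ae_restrict_mem D.isOpen.measurableSet, ae_restrict_of_ae h0]
          with x h1 h2 h3
        refine (Tendsto.liminf_eq ?_).ge
        refine ENNReal.Tendsto.const_mul ?_ (Or.inr (hwtop x h2))
        refine ((ENNReal.continuous_rpow_const (y := m)).tendsto _).comp ?_
        refine ENNReal.Tendsto.div_const ?_ (Or.inr (by simpa using h3))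
        exact (continuous_enorm.tendsto _).comp h1
    _ ≤ liminf (fun k => ∫⁻ x in D.Ω, w x * (‖fn (v (ns k)) x‖ₑ / ‖x‖ₑ) ^ m) atTop := by
        refine lintegral_liminf_le' fun k => ?_
        exact hw.aemeasurable.mul (((aestronglyMeasurable_fn _).enorm.div
          measurable_enorm.aemeasurable).pow_const _)
    _ ≤ liminf (fun k => ENNReal.ofReal ((m / (N - m)) ^ m) * (I u + I (v (ns k) - u)) ^ m)
        atTop := by
        refine liminf_le_liminf (Eventually.of_forall fun k => ?_)
        refine (lintegral_hardy_of_isTestElement hw hmono hm hmN (hvφ (ns k))).trans ?_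
        rw [← hIpow]
        gcongr
        exact hadd _
    _ = _ := hR.liminf_eq

/-- The integrand `|u|^p / |x|^p + a |u|^q / |x|^q` of the Hardy modular. -/
def hardyH (u : D.W0) (x : EuclideanSpace ℝ (Fin N)) : ℝ :=
  (|fn u x| / ‖x‖) ^ D.p + D.a x * (|fn u x| / ‖x‖) ^ D.q

lemma hardyH_eq (u : D.W0) (x : EuclideanSpace ℝ (Fin N)) :
    hardyH u x = D.H x (|fn u x| / ‖x‖) := rfl

lemma hardyH_nonneg (u : D.W0) {x : EuclideanSpace ℝ (Fin N)} (hx : x ∈ D.Ω) :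
    0 ≤ hardyH u x := H_nonneg hx (by positivity)

lemma ofReal_div_rpow (s : ℝ) {x : EuclideanSpace ℝ (Fin N)} (hx : x ≠ 0) {m : ℝ} (hm : 0 < m) :
    (‖s‖ₑ / ‖x‖ₑ) ^ m = ENNReal.ofReal ((|s| / ‖x‖) ^ m) := by
  rw [← ENNReal.ofReal_rpow_of_nonneg (by positivity) hm.le,
    ENNReal.ofReal_div_of_pos (norm_pos_iff.2 hx), ofReal_norm, ← Real.norm_eq_abs, ofReal_norm]

lemma inv_hardyConstant {m : ℝ} (hm : 0 < m) (hmN : m < N) :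
    (m / (N - m)) ^ m = (hardyConstant N m)⁻¹ := by
  have : 0 < m / (N - m) := div_pos hm (by linarith)
  rw [hardyConstant, Real.rpow_neg this.le, inv_inv]

lemma hardyConstant_pos {m : ℝ} (hm : 0 < m) (hmN : m < N) : 0 < hardyConstant N m :=
  Real.rpow_pos_of_pos (div_pos hm (by linarith)) _

/-- The weight is controlled only on the closure of `Ω`, whereas the Hardy inequality is stated for
globally measurable weights; a Lipschitz extension bridges the two. -/
lemma exists_measurable_weight (D : DoublePhase N) :
    ∃ b : EuclideanSpace ℝ (Fin N) → ℝ, Measurable b ∧ ∀ x ∈ closure D.Ω, b x = D.a x := by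
  obtain ⟨K, hK⟩ := D.a_lipschitz
  obtain ⟨b, hb, hab⟩ := hK.extend_real
  exact ⟨b, hb.continuous.measurable, fun x hx => (hab hx).symm⟩

lemma a_le_of_smul {x : EuclideanSpace ℝ (Fin N)} (hx : x ∈ D.Ω) {t : ℝ} (ht : 1 ≤ t)
    (htx : t • x ∈ D.Ω) : D.a x ≤ D.a (t • x) := by
  have ht0 : 0 < t := by linarith
  have h : t⁻¹ • t • x = x := inv_smul_smul₀ ht0.ne' x
  have := D.a_mono t⁻¹ (by positivity) (inv_le_one_of_one_le₀ ht) (t • x) (subset_closure htx)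
    (by rw [h]; exact subset_closure hx)
  rwa [h] at this

lemma ae_ne_zero (D : DoublePhase N) : ∀ᵐ x ∂D.μ, x ≠ 0 := by
  have : NeZero N := ⟨by have := D.two_le_dim; omega⟩
  refine ae_restrict_of_ae ?_
  simp [ae_iff]

/-- The modular Hardy inequality for the double phase integrand. -/
lemma lintegral_hardyH_le (u : D.W0) :
    ∫⁻ x in D.Ω, ENNReal.ofReal (hardyH u x) ≤
      ENNReal.ofReal (min (hardyConstant N D.p) (hardyConstant N D.q))⁻¹ *
        D.modular (grad u) := by
  obtain ⟨b, hb, hba⟩ := exists_measurable_weight D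
  have hp1 := D.one_lt_p
  have hpq := D.p_lt_q
  have hqN := D.q_lt_dim
  have hp0 : 0 < D.p := by linarith
  have hq0 : 0 < D.q := by linarith
  have hba' : ∀ x ∈ D.Ω, b x = D.a x := fun x hx => hba x (subset_closure hx)
  have hHp := lintegral_hardy_W0 (D := D) (w := fun _ => 1) measurable_const
    (fun _ _ _ _ _ => le_rfl) hp1 (by linarith) (fun x hx s hs => by
      rw [one_mul, ENNReal.ofReal_rpow_of_nonneg hs hp0.le]
      refine ENNReal.ofReal_le_ofReal ?_
      have := mul_nonneg (a_nonneg' hx) (Real.rpow_nonneg hs D.q)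
      unfold H; linarith) u
  have hHq := lintegral_hardy_W0 (D := D) (w := fun x => ENNReal.ofReal (b x))
    hb.ennreal_ofReal
    (fun x hx t ht htx => ENNReal.ofReal_le_ofReal (by
      rw [hba' x hx, hba' _ htx]; exact a_le_of_smul hx ht htx)) (hp1.trans hpq) hqN
    (fun x hx s hs => by
      rw [hba' x hx, ENNReal.ofReal_rpow_of_nonneg hs hq0.le, ← ENNReal.ofReal_mul (a_nonneg' hx)]
      refine ENNReal.ofReal_le_ofReal ?_
      have := Real.rpow_nonneg hs D.p
      unfold H; linarith) u
  have hcp := hardyConstant_pos hp0 (hpq.trans hqN)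
  have hcq := hardyConstant_pos hq0 hqN
  rw [inv_hardyConstant hp0 (by linarith)] at hHp
  rw [inv_hardyConstant hq0 hqN] at hHq
  set c := (min (hardyConstant N D.p) (hardyConstant N D.q))⁻¹ with hc
  have hlep : (hardyConstant N D.p)⁻¹ ≤ c := inv_anti₀ (lt_min hcp hcq) (min_le_left _ _)
  have hleq : (hardyConstant N D.q)⁻¹ ≤ c := inv_anti₀ (lt_min hcp hcq) (min_le_right _ _)
  have hmp : AEMeasurable (fun x => (1 : ℝ≥0∞) * (‖fn u x‖ₑ / ‖x‖ₑ) ^ D.p) D.μ :=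
    (((aestronglyMeasurable_fn _).enorm.div measurable_enorm.aemeasurable).pow_const _).const_mul _
  have hmg : AEMeasurable (fun x => (1 : ℝ≥0∞) * ‖grad u x‖ₑ ^ D.p) D.μ :=
    ((aestronglyMeasurable_grad _).enorm.pow_const _).const_mul _
  calc ∫⁻ x in D.Ω, ENNReal.ofReal (hardyH u x)
      = ∫⁻ x in D.Ω, (1 * (‖fn u x‖ₑ / ‖x‖ₑ) ^ D.p +
          ENNReal.ofReal (b x) * (‖fn u x‖ₑ / ‖x‖ₑ) ^ D.q) := by
        refine lintegral_congr_ae ?_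
        filter_upwards [ae_restrict_mem D.isOpen.measurableSet, ae_ne_zero D] with x hx hx0
        rw [ofReal_div_rpow _ hx0 hp0, ofReal_div_rpow _ hx0 hq0, hba' x hx, one_mul,
          ← ENNReal.ofReal_mul (a_nonneg' hx), ← ENNReal.ofReal_add (by positivity)
            (mul_nonneg (a_nonneg' hx) (by positivity))]
        rfl
    _ = (∫⁻ x in D.Ω, 1 * (‖fn u x‖ₑ / ‖x‖ₑ) ^ D.p) +
          ∫⁻ x in D.Ω, ENNReal.ofReal (b x) * (‖fn u x‖ₑ / ‖x‖ₑ) ^ D.q :=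
        lintegral_add_left' hmp _
    _ ≤ ENNReal.ofReal c * (∫⁻ x in D.Ω, 1 * ‖grad u x‖ₑ ^ D.p) +
          ENNReal.ofReal c * ∫⁻ x in D.Ω, ENNReal.ofReal (b x) * ‖grad u x‖ₑ ^ D.q := by
        gcongr
        · exact hHp.trans (by gcongr)
        · exact hHq.trans (by gcongr)
    _ = ENNReal.ofReal c * ∫⁻ x in D.Ω, (1 * ‖grad u x‖ₑ ^ D.p +
          ENNReal.ofReal (b x) * ‖grad u x‖ₑ ^ D.q) := by
        rw [← mul_add, ← lintegral_add_left' hmg]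
    _ = ENNReal.ofReal c * D.modular (grad u) := by
        congr 1
        refine setLIntegral_congr_fun D.isOpen.measurableSet fun x hx => ?_
        simp only [H]
        rw [← ofReal_norm, ENNReal.ofReal_rpow_of_nonneg (norm_nonneg _) hp0.le,
          ENNReal.ofReal_rpow_of_nonneg (norm_nonneg _) hq0.le, hba' x hx, one_mul,
          ← ENNReal.ofReal_mul (a_nonneg' hx), ← ENNReal.ofReal_add (by positivity)
            (mul_nonneg (a_nonneg' hx) (by positivity))]

end HardyW0

end DoublePhase

/-- Banach-Steinhaus applies to the images in the bidual: these act on the dual, which is complete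
even when `X` is not. -/
lemma exists_bound_of_weakly_convergent {X : Type*} [NormedAddCommGroup X] [NormedSpace ℝ X]
    {u : ℕ → X} {u₀ : X}
    (h : ∀ f : StrongDual ℝ X, Tendsto (fun j => f (u j)) atTop (𝓝 (f u₀))) :
    ∃ M : ℝ, ∀ j, ‖u j‖ ≤ M := by
  obtain ⟨M, hM⟩ := banach_steinhaus
    (g := fun j => NormedSpace.inclusionInDoubleDual ℝ X (u j)) (fun f => by
      obtain ⟨C, hC⟩ := (Metric.isBounded_range_of_tendsto _ (h f)).exists_norm_le
      exact ⟨C, fun j => hC _ ⟨j, rfl⟩⟩)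
  refine ⟨M, fun j => ?_⟩
  have h1 := (NormedSpace.inclusionInDoubleDualLi (𝕜 := ℝ) (E := X)).norm_map (u j)
  rw [← h1]
  exact hM j

/-! ### Translations and ball averages in `L^1` -/

section Translation

lemma setLIntegral_ball_eq {E : Type*} [NormedAddCommGroup E] [MeasurableSpace E] [BorelSpace E]
    (ν : Measure E) [ν.IsAddHaarMeasure] {g : E → ℝ≥0∞} (x : E) (r : ℝ) :
    ∫⁻ z in Metric.ball x r, g z ∂ν = ∫⁻ y in Metric.ball 0 r, g (x + y) ∂ν := by
  rw [← lintegral_indicator measurableSet_ball, ← lintegral_indicator measurableSet_ball,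
    ← lintegral_add_left_eq_self ((Metric.ball x r).indicator g) x]
  refine lintegral_congr fun y => ?_
  have h : x + y ∈ Metric.ball x r ↔ y ∈ Metric.ball 0 r := by
    rw [Metric.mem_ball, mem_ball_zero_iff, dist_eq_norm, add_sub_cancel_left]
  by_cases hy : y ∈ Metric.ball 0 r
  · rw [Set.indicator_of_mem hy, Set.indicator_of_mem (h.2 hy)]
  · rw [Set.indicator_of_notMem hy, Set.indicator_of_notMem (mt h.1 hy)]

variable {E : Type*} [NormedAddCommGroup E] [NormedSpace ℝ E] [MeasurableSpace E] [BorelSpace E]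
  [FiniteDimensional ℝ E] (ν : Measure E) [ν.IsAddHaarMeasure]

/-- The increment is the integral of the derivative over the segment from `x` to `x + y`; Tonelli
and translation invariance make every point of the segment contribute the same amount. -/
lemma lintegral_enorm_translate_sub_le {φ : E → ℝ} (hφ : ContDiff ℝ 1 φ) (y : E) :
    ∫⁻ x, ‖φ (x + y) - φ x‖ₑ ∂ν ≤ ‖y‖ₑ * ∫⁻ x, ‖fderiv ℝ φ x‖ₑ ∂ν := by
  have hfd : Continuous fun x => ‖fderiv ℝ φ x‖ₑ := (hφ.continuous_fderiv one_ne_zero).enorm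
  have hpt : ∀ x, ‖φ (x + y) - φ x‖ₑ ≤
      ∫⁻ t in Set.Ioc (0 : ℝ) 1, ‖fderiv ℝ φ (x + t • y)‖ₑ * ‖y‖ₑ := fun x => by
    have hd : ∀ t : ℝ, HasDerivAt (fun t : ℝ => φ (x + t • y)) (fderiv ℝ φ (x + t • y) y) t :=
      fun t => by
        have h1 : HasDerivAt (fun t : ℝ => x + t • y) y t := by
          simpa using ((hasDerivAt_id t).smul_const y).const_add x
        exact (hφ.differentiable one_ne_zero _).hasFDerivAt.comp_hasDerivAt t h1
    have hcont : Continuous fun t : ℝ => fderiv ℝ φ (x + t • y) y :=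
      ((hφ.continuous_fderiv one_ne_zero).comp (by fun_prop)).clm_apply continuous_const
    have h := intervalIntegral.integral_eq_sub_of_hasDerivAt (a := 0) (b := 1)
      (fun t _ => hd t) (hcont.intervalIntegrable 0 1)
    simp only [one_smul, zero_smul, add_zero] at h
    rw [← h, intervalIntegral.integral_of_le zero_le_one]
    refine (enorm_integral_le_lintegral_enorm _).trans (lintegral_mono fun t => ?_)
    exact (fderiv ℝ φ (x + t • y)).le_opENorm y
  calc ∫⁻ x, ‖φ (x + y) - φ x‖ₑ ∂ν
      ≤ ∫⁻ x, (∫⁻ t in Set.Ioc (0 : ℝ) 1, ‖fderiv ℝ φ (x + t • y)‖ₑ * ‖y‖ₑ) ∂ν :=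
        lintegral_mono hpt
    _ = ∫⁻ t in Set.Ioc (0 : ℝ) 1, (∫⁻ x, ‖fderiv ℝ φ (x + t • y)‖ₑ * ‖y‖ₑ ∂ν) := by
        refine lintegral_lintegral_swap (Measurable.aemeasurable ?_)
        have hc : Continuous fun z : E × ℝ => z.1 + z.2 • y := by fun_prop
        exact (hfd.comp hc).measurable.mul_const _
    _ = ∫⁻ t in Set.Ioc (0 : ℝ) 1, ‖y‖ₑ * ∫⁻ x, ‖fderiv ℝ φ x‖ₑ ∂ν := by
        refine lintegral_congr fun t => ?_
        rw [lintegral_mul_const' _ _ enorm_ne_top, mul_comm,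
          lintegral_add_right_eq_self (fun x => ‖fderiv ℝ φ x‖ₑ) (t • y)]
    _ = _ := by simp

/-- A function is controlled in `L^1` by its averages on small balls and its gradient. -/
lemma measure_ball_mul_lintegral_le {φ : E → ℝ} (hφ : ContDiff ℝ 1 φ) (S : Set E) (r : ℝ) :
    ν (Metric.ball 0 r) * ∫⁻ x in S, ‖φ x‖ₑ ∂ν ≤
      (∫⁻ x in S, ‖∫ z in Metric.ball x r, φ z ∂ν‖ₑ ∂ν) +
        ν (Metric.ball 0 r) * (ENNReal.ofReal r * ∫⁻ x, ‖fderiv ℝ φ x‖ₑ ∂ν) := by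
  have hball : ν (Metric.ball 0 r) ≠ ⊤ := measure_ball_lt_top.ne
  have hcφ : Continuous φ := hφ.continuous
  have hint : ∀ x, IntegrableOn φ (Metric.ball x r) ν := fun x =>
    (hcφ.continuousOn.integrableOn_compact (isCompact_closedBall x r)).mono_set
      Metric.ball_subset_closedBall
  have hdiff : Measurable fun z : E × E => ‖φ (z.1 + z.2) - φ z.1‖ₑ :=
    (by fun_prop : Continuous fun z : E × E => φ (z.1 + z.2) - φ z.1).enorm.measurable
  -- The constant `φ x`, integrated over the ball, is split as `φ z - (φ z - φ x)`; the second term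
  -- is a superposition of translation increments.
  have hpt : ∀ x, ν (Metric.ball 0 r) * ‖φ x‖ₑ ≤ ‖∫ z in Metric.ball x r, φ z ∂ν‖ₑ +
      ∫⁻ y in Metric.ball 0 r, ‖φ (x + y) - φ x‖ₑ ∂ν := fun x => by
    have hb : ν (Metric.ball x r) = ν (Metric.ball 0 r) := Measure.addHaar_ball_center ν x r
    have hc : IntegrableOn (fun _ => φ x) (Metric.ball x r) ν :=
      integrableOn_const measure_ball_lt_top.ne
    have h1 : ∫ z in Metric.ball x r, φ x ∂ν =
        (∫ z in Metric.ball x r, φ z ∂ν) - ∫ z in Metric.ball x r, (φ z - φ x) ∂ν := by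
      rw [integral_sub (hint x) hc]; ring
    have h2 : ‖∫ z in Metric.ball x r, φ x ∂ν‖ₑ = ν (Metric.ball 0 r) * ‖φ x‖ₑ := by
      rw [setIntegral_const, enorm_smul, measureReal_def, hb,
        Real.enorm_of_nonneg ENNReal.toReal_nonneg, ENNReal.ofReal_toReal hball]
    rw [← h2, h1]
    refine (enorm_sub_le).trans ?_
    gcongr
    refine (enorm_integral_le_lintegral_enorm _).trans (le_of_eq ?_)
    exact setLIntegral_ball_eq ν x r
  calc ν (Metric.ball 0 r) * ∫⁻ x in S, ‖φ x‖ₑ ∂ν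
      = ∫⁻ x in S, ν (Metric.ball 0 r) * ‖φ x‖ₑ ∂ν := (lintegral_const_mul' _ _ hball).symm
    _ ≤ ∫⁻ x in S, (‖∫ z in Metric.ball x r, φ z ∂ν‖ₑ +
          ∫⁻ y in Metric.ball 0 r, ‖φ (x + y) - φ x‖ₑ ∂ν) ∂ν := lintegral_mono hpt
    _ = (∫⁻ x in S, ‖∫ z in Metric.ball x r, φ z ∂ν‖ₑ ∂ν) +
          ∫⁻ x in S, (∫⁻ y in Metric.ball 0 r, ‖φ (x + y) - φ x‖ₑ ∂ν) ∂ν :=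
        lintegral_add_right _ hdiff.lintegral_prod_right'
    _ ≤ (∫⁻ x in S, ‖∫ z in Metric.ball x r, φ z ∂ν‖ₑ ∂ν) +
          ∫⁻ x, (∫⁻ y in Metric.ball 0 r, ‖φ (x + y) - φ x‖ₑ ∂ν) ∂ν :=
        add_le_add le_rfl (setLIntegral_le_lintegral _ _)
    _ ≤ _ := by
        gcongr
        rw [lintegral_lintegral_swap hdiff.aemeasurable]
        calc _ ≤ ∫⁻ y in Metric.ball 0 r,
              ENNReal.ofReal r * ∫⁻ x, ‖fderiv ℝ φ x‖ₑ ∂ν ∂ν := by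
              refine setLIntegral_mono' measurableSet_ball fun y hy => ?_
              refine (lintegral_enorm_translate_sub_le ν hφ y).trans ?_
              gcongr
              rw [← ofReal_norm]
              exact ENNReal.ofReal_le_ofReal (mem_ball_zero_iff.1 hy).le
          _ = _ := by rw [setLIntegral_const, mul_comm]

lemma stronglyMeasurable_integral_ball {φ : E → ℝ} (hφ : Continuous φ) (r : ℝ) :
    StronglyMeasurable fun x => ∫ z in Metric.ball x r, φ z ∂ν := by
  have h : ∀ x, ∫ z in Metric.ball x r, φ z ∂ν =
      ∫ z, ({w : E × E | dist w.2 w.1 < r}.indicator fun w => φ w.2) (x, z) ∂ν := fun x => by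
    rw [← integral_indicator measurableSet_ball]
    rfl
  simp_rw [h]
  refine StronglyMeasurable.integral_prod_right' (StronglyMeasurable.indicator ?_ ?_)
  · exact (hφ.comp continuous_snd).stronglyMeasurable
  · exact (isOpen_lt (by fun_prop) continuous_const).measurableSet

end Translation

namespace DoublePhase

variable {N : ℕ} {D : DoublePhase N}

/-! ### From weak convergence in `W0` to strong convergence in `L^1` -/

section Compactness

lemma integrable_fn (u : D.W0) : Integrable (fn u) D.μ := LH.integrable u.1.1.fst

lemma volume_add_one_ne_top (D : DoublePhase N) : volume D.Ω + 1 ≠ ⊤ :=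
  ENNReal.add_ne_top.2 ⟨D.isBounded.measure_lt_top.ne, ENNReal.one_ne_top⟩

lemma enorm_setIntegral_fn_le (S : Set (EuclideanSpace ℝ (Fin N))) (u : D.W0) :
    ‖∫ x in S, fn u x ∂D.μ‖ₑ ≤ (volume D.Ω + 1) * ENNReal.ofReal ‖u‖ :=
  (enorm_integral_le_lintegral_enorm _).trans
    ((setLIntegral_le_lintegral _ _).trans (lintegral_fn_le u))

/-- Integration over a set, as a continuous functional on `W_0^{1,H}(Ω)`. -/
def setIntegralCLM (S : Set (EuclideanSpace ℝ (Fin N))) : StrongDual ℝ D.W0 :=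
  LinearMap.mkContinuous
    { toFun := fun u => ∫ x in S, fn u x ∂D.μ
      map_add' := fun u v => by
        rw [← integral_add (integrable_fn u).integrableOn (integrable_fn v).integrableOn]
        exact integral_congr_ae (ae_restrict_of_ae (fn_add u v))
      map_smul' := fun c u => by
        rw [RingHom.id_apply, smul_eq_mul, ← integral_const_mul]
        exact integral_congr_ae (ae_restrict_of_ae (fn_smul c u)) }
    (volume D.Ω + 1).toReal fun u => by
      have h := enorm_setIntegral_fn_le S u
      rw [← ofReal_norm, ← ENNReal.ofReal_toReal (volume_add_one_ne_top D),
        ← ENNReal.ofReal_mul ENNReal.toReal_nonneg] at h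
      exact (ENNReal.ofReal_le_ofReal_iff (by positivity)).1 h

lemma setIntegralCLM_apply (S : Set (EuclideanSpace ℝ (Fin N))) (u : D.W0) :
    setIntegralCLM S u = ∫ x in S, fn u x ∂D.μ := rfl

lemma IsTestElement.setIntegral_eq {u : D.W0} {φ : EuclideanSpace ℝ (Fin N) → ℝ}
    (h : IsTestElement u φ) {S : Set (EuclideanSpace ℝ (Fin N))} (hS : MeasurableSet S) :
    ∫ x in S, φ x = ∫ x in S, fn u x ∂D.μ := by
  rw [integral_congr_ae (ae_restrict_of_ae h.2.1), Measure.restrict_restrict hS]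
  refine setIntegral_eq_of_subset_of_forall_sdiff_eq_zero (f := φ) hS Set.inter_subset_left
    fun x hx => ?_
  by_contra h0
  exact hx.2 ⟨hx.1, h.1.2.2 (subset_tsupport _ h0)⟩

lemma IsTestElement.lintegral_fderiv_eq {u : D.W0} {φ : EuclideanSpace ℝ (Fin N) → ℝ}
    (h : IsTestElement u φ) :
    ∫⁻ x, ‖fderiv ℝ φ x‖ₑ = ∫⁻ x in D.Ω, ‖grad u x‖ₑ := by
  have h1 : ∫⁻ x in D.Ω, ‖grad u x‖ₑ = ∫⁻ x in D.Ω, ‖fderiv ℝ φ x‖ₑ := by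
    refine lintegral_congr_ae ?_
    filter_upwards [h.2.2] with x hx
    rw [hx, gradient, ← ofReal_norm, LinearIsometryEquiv.norm_map, ofReal_norm]
  rw [h1, ← lintegral_indicator D.isOpen.measurableSet]
  refine lintegral_congr fun x => ?_
  by_cases hx : x ∈ D.Ω
  · rw [Set.indicator_of_mem hx]
  · rw [Set.indicator_of_notMem hx, ← ofReal_norm]
    have : fderiv ℝ φ x = 0 := by
      by_contra h0
      exact hx (h.1.2.2 (support_fderiv_subset ℝ h0))
    rw [this, norm_zero, ENNReal.ofReal_zero]

/-- For a fixed radius, integrals over balls are continuous functionals, so they tend to zero at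
every center; they are bounded by one constant and `Ω` has finite measure, so dominated convergence
applies. The error relative to the averages is at most `r` times the gradient bound, uniformly in
`j`: the radius is chosen first, then `j`. -/
lemma tendsto_lintegral_fn_of_test {v : ℕ → D.W0}
    {φ : ℕ → EuclideanSpace ℝ (Fin N) → ℝ} (hv : ∀ j, IsTestElement (v j) (φ j))
    (hw : ∀ f : StrongDual ℝ D.W0, Tendsto (fun j => f (v j)) atTop (𝓝 0)) :
    Tendsto (fun j => ∫⁻ x in D.Ω, ‖fn (v j) x‖ₑ) atTop (𝓝 0) := by
  obtain ⟨M, hM⟩ := exists_bound_of_weakly_convergent (u := v) (u₀ := 0)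
    (fun f => by rw [map_zero]; exact hw f)
  set C : ℝ≥0∞ := (volume D.Ω + 1) * ENNReal.ofReal M with hC
  have hCtop : C ≠ ⊤ := ENNReal.mul_ne_top (volume_add_one_ne_top D) ENNReal.ofReal_ne_top
  have hfC : ∀ (S : Set (EuclideanSpace ℝ (Fin N))) (j : ℕ),
      ‖∫ x in S, fn (v j) x ∂D.μ‖ₑ ≤ C := fun S j =>
    (enorm_setIntegral_fn_le S (v j)).trans (by rw [hC]; gcongr; exact hM j)
  have havg : ∀ r : ℝ, Tendsto (fun j => ∫⁻ x in D.Ω, ‖∫ z in Metric.ball x r, φ j z‖ₑ)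
      atTop (𝓝 0) := fun r => by
    have h := tendsto_lintegral_of_dominated_convergence (μ := D.μ) (f := fun _ => 0)
      (F := fun j x => ‖∫ z in Metric.ball x r, φ j z‖ₑ) (fun _ => C)
      (fun j => (stronglyMeasurable_integral_ball volume (hv j).1.1.continuous r).enorm)
      (fun j => ae_of_all _ fun x => by
        simp only [(hv j).setIntegral_eq measurableSet_ball]
        exact hfC _ j)
      (by
        rw [lintegral_const, Measure.restrict_apply_univ]
        exact ENNReal.mul_ne_top hCtop D.isBounded.measure_lt_top.ne)
      (ae_of_all _ fun x => by
        have h1 := (hw (setIntegralCLM (Metric.ball x r))).enorm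
        simp only [setIntegralCLM_apply] at h1
        simp only [(hv _).setIntegral_eq measurableSet_ball]
        rwa [enorm_zero] at h1)
    rwa [lintegral_zero] at h
  rw [ENNReal.tendsto_nhds_zero]
  intro δ hδ
  have hδ2 : 0 < δ / 2 := ENNReal.half_pos hδ.ne'
  obtain ⟨r, hr, hrδ⟩ : ∃ r : ℝ, 0 < r ∧ ENNReal.ofReal r * C ≤ δ / 2 := by
    have h1 : Tendsto (fun r : ℝ => ENNReal.ofReal r * C) (𝓝[>] 0) (𝓝 0) := by
      have := ENNReal.Tendsto.mul_const (b := C) ((ENNReal.continuous_ofReal.tendsto 0).mono_left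
        (nhdsWithin_le_nhds (s := Set.Ioi 0))) (Or.inr hCtop)
      rwa [ENNReal.ofReal_zero, zero_mul] at this
    obtain ⟨r, h2, h3⟩ := ((h1.eventually_le_const hδ2).and self_mem_nhdsWithin).exists
    exact ⟨r, h3, h2⟩
  set V := volume (Metric.ball (0 : EuclideanSpace ℝ (Fin N)) r) with hV
  have hV0 : V ≠ 0 := (Metric.measure_ball_pos volume _ hr).ne'
  have hVtop : V ≠ ⊤ := measure_ball_lt_top.ne
  have hVδ : 0 < V * (δ / 2) := pos_iff_ne_zero.2 (mul_ne_zero hV0 hδ2.ne')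
  filter_upwards [(havg r).eventually_le_const hVδ] with j hj
  have h1 := measure_ball_mul_lintegral_le volume ((hv j).1.1.of_le (by simp)) D.Ω r
  rw [(hv j).lintegral_fderiv_eq] at h1
  have h2 : ∫⁻ x in D.Ω, ‖grad (v j) x‖ₑ ≤ C :=
    (lintegral_grad_le (v j)).trans (by rw [hC]; gcongr; exact hM j)
  have h3 : ∫⁻ x in D.Ω, ‖fn (v j) x‖ₑ = ∫⁻ x in D.Ω, ‖φ j x‖ₑ := by
    refine lintegral_congr_ae ?_
    filter_upwards [(hv j).2.1] with x hx
    rw [hx]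
  rw [h3]
  have h4 : V * ∫⁻ x in D.Ω, ‖φ j x‖ₑ ≤ V * δ := by
    refine h1.trans ?_
    calc _ ≤ V * (δ / 2) + V * (ENNReal.ofReal r * C) := by gcongr
      _ ≤ V * (δ / 2) + V * (δ / 2) := by gcongr
      _ = V * δ := by rw [← mul_add, ENNReal.add_halves]
  exact (ENNReal.mul_le_mul_iff_right hV0 hVtop).1 h4

/-- Weak convergence in `W_0^{1,H}(Ω)` implies strong convergence in `L^1(Ω)`. -/
lemma tendsto_lintegral_fn_of_weak {w : ℕ → D.W0}
    (hw : ∀ f : StrongDual ℝ D.W0, Tendsto (fun j => f (w j)) atTop (𝓝 0)) :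
    Tendsto (fun j => ∫⁻ x in D.Ω, ‖fn (w j) x‖ₑ) atTop (𝓝 0) := by
  -- Test elements within `1 / (j + 1)` of `w j` are again weakly null, and they differ from `w j`
  -- by a null sequence in `L^1`.
  choose v φ hvφ hvw using fun j : ℕ =>
    exists_isTestElement_norm_sub_lt (w j) (Nat.one_div_pos_of_nat (α := ℝ) (n := j))
  have hlim : Tendsto (fun j => ‖v j - w j‖) atTop (𝓝 0) :=
    squeeze_zero (fun _ => norm_nonneg _) (fun k => (hvw k).le)
      tendsto_one_div_add_atTop_nhds_zero_nat
  have hv : ∀ f : StrongDual ℝ D.W0, Tendsto (fun j => f (v j)) atTop (𝓝 0) := fun f => by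
    have h1 : Tendsto (fun j => f (v j - w j)) atTop (𝓝 0) := by
      have := (f.continuous.tendsto 0).comp (tendsto_zero_iff_norm_tendsto_zero.2 hlim)
      rwa [map_zero] at this
    have h2 := h1.add (hw f)
    rw [add_zero] at h2
    refine h2.congr fun j => ?_
    rw [map_sub, sub_add_cancel]
  have h1 := tendsto_lintegral_fn_of_test hvφ hv
  have h2 : Tendsto (fun j => (volume D.Ω + 1) * ENNReal.ofReal ‖v j - w j‖) atTop (𝓝 0) := by
    have := ENNReal.Tendsto.const_mul (ENNReal.tendsto_ofReal hlim)
      (a := volume D.Ω + 1) (Or.inr (volume_add_one_ne_top D))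
    rwa [ENNReal.ofReal_zero, mul_zero] at this
  have h3 := h1.add h2
  rw [add_zero] at h3
  refine tendsto_of_tendsto_of_tendsto_of_le_of_le tendsto_const_nhds h3 (fun _ => zero_le)
    fun j => ?_
  refine le_trans ?_ (add_le_add le_rfl (lintegral_fn_le (v j - w j)))
  rw [← lintegral_add_left' (aestronglyMeasurable_fn _).enorm]
  refine lintegral_mono_ae ?_
  filter_upwards [fn_sub (v j) (w j)] with x hx
  calc ‖fn (w j) x‖ₑ = ‖fn (v j) x - fn (v j - w j) x‖ₑ := by rw [hx, sub_sub_cancel]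
    _ ≤ _ := enorm_sub_le

end Compactness

end DoublePhase

/-! ### Brezis-Lieb inequality and its limit theorem -/

section BrezisLieb

lemma rpow_sub_two_mul_mul_self {m : ℝ} (hm : 0 < m) {s : ℝ} (hs : 0 ≤ s) :
    s ^ (m - 2) * s * s = s ^ m := by
  rcases hs.eq_or_lt with rfl | h
  · rw [mul_zero, Real.zero_rpow hm.ne']
  · rw [mul_assoc, ← pow_two, ← Real.rpow_two, ← Real.rpow_add h, sub_add_cancel]

/-- Replacing both variables by the larger one gives a crude Young inequality, which suffices for
absolute convergence of all the integrals. -/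
lemma rpow_sub_two_mul_mul_le {m : ℝ} (hm : 2 ≤ m) {s t : ℝ} (hs : 0 ≤ s) (ht : 0 ≤ t) :
    s ^ (m - 2) * s * t ≤ s ^ m + t ^ m := by
  have hm0 : 0 < m := by linarith
  have hm2 : 0 ≤ m - 2 := by linarith
  have h1 := Real.rpow_nonneg hs m
  have h2 := Real.rpow_nonneg ht m
  rcases le_total s t with h | h
  · calc s ^ (m - 2) * s * t ≤ t ^ (m - 2) * t * t := by gcongr
      _ = t ^ m := rpow_sub_two_mul_mul_self hm0 ht
      _ ≤ _ := by linarith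
  · calc s ^ (m - 2) * s * t ≤ s ^ (m - 2) * s * s := by gcongr
      _ = s ^ m := rpow_sub_two_mul_mul_self hm0 hs
      _ ≤ _ := by linarith

/-- The expression is continuous and vanishes at `τ = 0`, hence is below `ε` for `|τ| < δ`. For `|τ|
≥ δ` each of its three terms is at most `(1 + |τ|) ^ m ≤ ((1 / δ + 1) |τ|) ^ m`, which explains the
constant. -/
lemma exists_abs_rpow_one_add_sub_le {m : ℝ} (hm : 2 ≤ m) {ε : ℝ} (hε : 0 < ε) :
    ∃ C : ℝ, 0 ≤ C ∧ ∀ τ : ℝ,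
      |(|1 + τ| ^ (m - 2) * (1 + τ)) - |τ| ^ (m - 2) * τ - 1| ≤ ε + C * |τ| ^ m := by
  have hm0 : 0 < m := by linarith
  have hm2 : 0 ≤ m - 2 := by linarith
  have hcont : Continuous fun s : ℝ => |s| ^ (m - 2) * s :=
    (continuous_abs.rpow_const fun _ => Or.inr hm2).mul continuous_id
  have hc : Continuous fun τ : ℝ => |1 + τ| ^ (m - 2) * (1 + τ) - |τ| ^ (m - 2) * τ - 1 :=
    ((hcont.comp (continuous_const.add continuous_id)).sub hcont).sub continuous_const
  obtain ⟨δ, hδ, h⟩ := Metric.continuousAt_iff.1 (hc.continuousAt (x := 0)) ε hε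
  refine ⟨3 * (1 / δ + 1) ^ m, by positivity, fun τ => ?_⟩
  rcases lt_or_ge |τ| δ with hτ | hτ
  · have h1 := h (x := τ) (by simpa using hτ)
    simp only [Real.dist_eq, add_zero, abs_one, Real.one_rpow, mul_one, mul_zero, sub_zero,
      sub_self] at h1
    have : 0 ≤ 3 * (1 / δ + 1) ^ m * |τ| ^ m := by positivity
    linarith
  · set y := 1 + |τ| with hy
    have hy1 : 1 ≤ y := by linarith [abs_nonneg τ]
    have hy0 : 0 ≤ y := by linarith
    have key : ∀ x : ℝ, |x| ≤ y → |(|x| ^ (m - 2) * x)| ≤ y ^ m := fun x hx => by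
      rw [abs_mul, abs_of_nonneg (Real.rpow_nonneg (abs_nonneg x) _)]
      calc |x| ^ (m - 2) * |x| ≤ y ^ (m - 2) * y := by gcongr
        _ ≤ y ^ (m - 2) * y * y := le_mul_of_one_le_right (by positivity) hy1
        _ = y ^ m := rpow_sub_two_mul_mul_self hm0 hy0
    have k1 := key (1 + τ) (by simpa using abs_add_le 1 τ)
    have k2 := key τ (by linarith)
    have k3 : 1 ≤ y ^ m := Real.one_le_rpow hy1 hm0.le
    have k4 : y ^ m ≤ (1 / δ + 1) ^ m * |τ| ^ m := by
      rw [← Real.mul_rpow (by positivity) (abs_nonneg _)]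
      refine Real.rpow_le_rpow hy0 ?_ hm0.le
      have : 1 ≤ 1 / δ * |τ| := by
        rw [one_div, ← div_eq_inv_mul]; exact (one_le_div hδ).2 hτ
      linarith
    rw [abs_le] at k1 k2 ⊢
    constructor <;> linarith [k1.1, k1.2, k2.1, k2.2]

/-- The Brezis-Lieb inequality for the monotone form of `s ↦ |s|^(m-2) s`. -/
lemma exists_abs_brezisLieb_le {m : ℝ} (hm : 2 ≤ m) {ε : ℝ} (hε : 0 < ε) :
    ∃ C : ℝ, 0 ≤ C ∧ ∀ s t : ℝ,
      |(|s| ^ (m - 2) * s * (s - t) - |t| ^ (m - 2) * t * (s - t) - |s - t| ^ m)| ≤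
        ε * |s - t| ^ m + C * |t| ^ m := by
  have hm0 : 0 < m := by linarith
  obtain ⟨C, hC, h⟩ := exists_abs_rpow_one_add_sub_le hm hε
  refine ⟨C, hC, fun s t => ?_⟩
  obtain ⟨d, rfl⟩ : ∃ d, s = t + d := ⟨s - t, by ring⟩
  rw [add_sub_cancel_left]
  rcases eq_or_ne d 0 with rfl | hd
  · simp only [mul_zero, abs_zero, Real.zero_rpow hm0.ne', sub_zero]
    positivity
  -- Both sides are homogeneous of degree `m` in `(s, t)`, so dividing by `d = s - t` leaves a
  -- one-variable estimate.
  obtain ⟨τ, rfl⟩ : ∃ τ, t = d * τ := ⟨t / d, by field_simp⟩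
  have e : ∀ x : ℝ, |d * x| ^ (m - 2) * (d * x) * d = |d| ^ m * (|x| ^ (m - 2) * x) := fun x => by
    rw [abs_mul, Real.mul_rpow (abs_nonneg _) (abs_nonneg _),
      ← rpow_sub_two_mul_mul_self hm0 (abs_nonneg d)]
    linear_combination (-(|d| ^ (m - 2) * |x| ^ (m - 2) * x)) * abs_mul_abs_self d
  rw [show d * τ + d = d * (1 + τ) by ring, e, e, abs_mul d τ,
    Real.mul_rpow (abs_nonneg _) (abs_nonneg _)]
  have hd0 : 0 ≤ |d| ^ m := by positivity
  calc _ = |d| ^ m * |(|1 + τ| ^ (m - 2) * (1 + τ)) - |τ| ^ (m - 2) * τ - 1| := by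
        rw [← abs_of_nonneg hd0, ← abs_mul, abs_of_nonneg hd0]; congr 1; ring
    _ ≤ |d| ^ m * (ε + C * |τ| ^ m) := by gcongr; exact h τ
    _ = _ := by ring

/-- The excess `max (|R j| - ε h j) 0` is dominated by `|g|` and tends to zero a.e., so its integral
vanishes in the limit; what was removed integrates to at most `ε K`. No single dominating function
for `R j` is required. -/
lemma tendsto_integral_of_abs_le_add {α : Type*} [MeasurableSpace α] {μ : Measure α}
    {R h : ℕ → α → ℝ} {K : ℝ} (hR : ∀ j, Integrable (R j) μ) (hh : ∀ j, Integrable (h j) μ)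
    (hh0 : ∀ j, 0 ≤ᵐ[μ] h j) (hK : ∀ j, ∫ x, h j x ∂μ ≤ K)
    (hle : ∀ ε : ℝ, 0 < ε → ∃ g : α → ℝ, Integrable g μ ∧
      ∀ j, ∀ᵐ x ∂μ, |R j x| ≤ ε * h j x + g x)
    (hlim : ∀ᵐ x ∂μ, Tendsto (fun j => R j x) atTop (𝓝 0)) :
    Tendsto (fun j => ∫ x, R j x ∂μ) atTop (𝓝 0) := by
  have hK0 : 0 ≤ K := (integral_nonneg_of_ae (hh0 0)).trans (hK 0)
  -- Below, `ε = δ / (2 (K + 1))` yields `ε K ≤ δ / 2`, the summand `1` covering the case `K = 0`.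
  rw [Metric.tendsto_nhds]
  intro δ hδ
  set ε := δ / (2 * (K + 1)) with hε
  have hε0 : 0 < ε := by positivity
  have hεK : ε * K ≤ δ / 2 := by
    have : ε * (K + 1) = δ / 2 := by rw [hε]; field_simp
    nlinarith
  obtain ⟨g, hg, hgle⟩ := hle ε hε0
  set P : ℕ → α → ℝ := fun j x => max (|R j x| - ε * h j x) 0 with hP
  have hPint : ∀ j, Integrable (P j) μ := fun j => ((hR j).abs.sub ((hh j).const_mul ε)).pos_part
  have hPle : ∀ j, ∀ᵐ x ∂μ, ‖P j x‖ ≤ |g x| := fun j => by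
    filter_upwards [hgle j] with x hx
    rw [Real.norm_of_nonneg (le_max_right _ _)]
    exact max_le (by linarith [le_abs_self (g x)]) (abs_nonneg _)
  have hPlim : ∀ᵐ x ∂μ, Tendsto (fun j => P j x) atTop (𝓝 0) := by
    filter_upwards [hlim, ae_all_iff.2 hh0] with x hx hx0
    refine squeeze_zero (fun j => le_max_right _ _) (fun j => ?_)
      ((tendsto_zero_iff_abs_tendsto_zero _).1 hx)
    have : 0 ≤ ε * h j x := mul_nonneg hε0.le (hx0 j)
    exact max_le (by simp only [Function.comp_apply]; linarith) (abs_nonneg _)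
  have hPI : Tendsto (fun j => ∫ x, P j x ∂μ) atTop (𝓝 0) := by
    have := tendsto_integral_of_dominated_convergence (fun x => |g x|)
      (fun j => (hPint j).aestronglyMeasurable) hg.abs hPle hPlim
    rwa [integral_zero] at this
  filter_upwards [hPI.eventually_lt_const (half_pos hδ)] with j hj
  rw [Real.dist_0_eq_abs]
  calc |∫ x, R j x ∂μ| ≤ ∫ x, |R j x| ∂μ := abs_integral_le_integral_abs
    _ ≤ ∫ x, (ε * h j x + P j x) ∂μ := by
        refine integral_mono (hR j).abs (((hh j).const_mul ε).add (hPint j)) fun x => ?_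
        have := le_max_left (|R j x| - ε * h j x) 0
        simp only [hP]
        linarith
    _ = ε * ∫ x, h j x ∂μ + ∫ x, P j x ∂μ := by
        rw [integral_add ((hh j).const_mul ε) (hPint j), integral_const_mul]
    _ < δ := by
        have := mul_le_mul_of_nonneg_left (hK j) hε0.le
        linarith

end BrezisLieb

namespace DoublePhase

variable {N : ℕ} {D : DoublePhase N}

/-! ### Integrability of the densities and construction of the operator -/

section Densities

lemma aemeasurable_a (D : DoublePhase N) : AEMeasurable D.a D.μ := by
  obtain ⟨K, hK⟩ := D.a_lipschitz
  exact (hK.continuousOn.mono subset_closure).aemeasurable D.isOpen.measurableSet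

lemma integrable_H_grad (u : D.W0) : Integrable (fun x => D.H x ‖grad u x‖) D.μ := by
  have hn := (aestronglyMeasurable_grad u).norm.aemeasurable
  have hm : AEMeasurable (fun x => D.H x ‖grad u x‖) D.μ :=
    (hn.pow_const _).add ((aemeasurable_a D).mul (hn.pow_const _))
  refine ⟨hm.aestronglyMeasurable, ?_⟩
  rw [hasFiniteIntegral_iff_ofReal]
  · exact LH.modular_lt_top u.1.1.snd
  · filter_upwards [ae_restrict_mem D.isOpen.measurableSet] with x hx
      using H_nonneg hx (norm_nonneg _)

lemma ofReal_integral_H_grad (u : D.W0) :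
    ENNReal.ofReal (∫ x in D.Ω, D.H x ‖grad u x‖) = D.modular (grad u) :=
  ofReal_integral_eq_lintegral_ofReal (integrable_H_grad u) (by
    filter_upwards [ae_restrict_mem D.isOpen.measurableSet] with x hx
      using H_nonneg hx (norm_nonneg _))

lemma integral_H_grad_nonneg (u : D.W0) : 0 ≤ ∫ x in D.Ω, D.H x ‖grad u x‖ :=
  setIntegral_nonneg D.isOpen.measurableSet fun _ hx => H_nonneg hx (norm_nonneg _)

lemma aemeasurable_hardyH (u : D.W0) : AEMeasurable (hardyH u) D.μ := by
  have hn : AEMeasurable (fun x => |fn u x| / ‖x‖) D.μ :=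
    (aestronglyMeasurable_fn u).norm.aemeasurable.div measurable_norm.aemeasurable
  exact (hn.pow_const _).add ((aemeasurable_a D).mul (hn.pow_const _))

lemma integrable_hardyH (u : D.W0) : Integrable (hardyH u) D.μ := by
  refine ⟨(aemeasurable_hardyH u).aestronglyMeasurable, ?_⟩
  rw [hasFiniteIntegral_iff_ofReal]
  · exact (lintegral_hardyH_le u).trans_lt
      (ENNReal.mul_lt_top ENNReal.ofReal_lt_top (LH.modular_lt_top u.1.1.snd))
  · filter_upwards [ae_restrict_mem D.isOpen.measurableSet] with x hx using hardyH_nonneg u hx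

lemma integral_hardyH_nonneg (u : D.W0) : 0 ≤ ∫ x in D.Ω, hardyH u x :=
  setIntegral_nonneg D.isOpen.measurableSet fun _ hx => hardyH_nonneg u hx

lemma hardyConstant_min_pos (D : DoublePhase N) :
    0 < min (hardyConstant N D.p) (hardyConstant N D.q) :=
  lt_min (hardyConstant_pos p_pos (D.p_lt_q.trans D.q_lt_dim))
    (hardyConstant_pos q_pos D.q_lt_dim)

lemma integral_hardyH_le (u : D.W0) :
    ∫ x in D.Ω, hardyH u x ≤ (min (hardyConstant N D.p) (hardyConstant N D.q))⁻¹ *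
      ∫ x in D.Ω, D.H x ‖grad u x‖ := by
  have hc := inv_pos.2 (hardyConstant_min_pos D)
  have h := lintegral_hardyH_le u
  rw [← ofReal_integral_H_grad, ← ENNReal.ofReal_mul hc.le,
    ← ofReal_integral_eq_lintegral_ofReal (integrable_hardyH u)] at h
  · exact (ENNReal.ofReal_le_ofReal_iff
      (mul_nonneg hc.le (integral_H_grad_nonneg u))).1 h
  · filter_upwards [ae_restrict_mem D.isOpen.measurableSet] with x hx using hardyH_nonneg u hx

/-- In terms of the quotients `u / |x|` and `v / |x|` the singular factor disappears, so scalar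
inequalities apply directly. -/
lemma hardyDensity_eq (u v : D.W0) {x : EuclideanSpace ℝ (Fin N)} (hx : x ≠ 0) :
    hardyDensity u v x =
      |fn u x / ‖x‖| ^ (D.p - 2) * (fn u x / ‖x‖) * (fn v x / ‖x‖) +
        D.a x * (|fn u x / ‖x‖| ^ (D.q - 2) * (fn u x / ‖x‖) * (fn v x / ‖x‖)) := by
  have hx0 : 0 < ‖x‖ := norm_pos_iff.2 hx
  have e : ∀ m : ℝ, 0 < m → |fn u x| ^ (m - 2) * fn u x / ‖x‖ ^ m * fn v x =
      |fn u x / ‖x‖| ^ (m - 2) * (fn u x / ‖x‖) * (fn v x / ‖x‖) := fun m hm => by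
    rw [← rpow_sub_two_mul_mul_self hm hx0.le, abs_div, abs_norm,
      Real.div_rpow (abs_nonneg _) hx0.le]
    have : ‖x‖ ^ (m - 2) ≠ 0 := (Real.rpow_pos_of_pos hx0 _).ne'
    field_simp
  rw [hardyDensity, e _ p_pos, mul_assoc (D.a x), e _ q_pos]

lemma abs_phaseDensity_le (hp : 2 ≤ D.p) (u v : D.W0) {x : EuclideanSpace ℝ (Fin N)}
    (hx : x ∈ D.Ω) :
    |phaseDensity u v x| ≤ D.H x ‖grad u x‖ + D.H x ‖grad v x‖ := by
  have ha := a_nonneg' hx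
  have hq : 2 ≤ D.q := hp.trans D.p_lt_q.le
  have h1 := rpow_sub_two_mul_mul_le hp (norm_nonneg (grad u x)) (norm_nonneg (grad v x))
  have h2 := mul_le_mul_of_nonneg_left
    (rpow_sub_two_mul_mul_le hq (norm_nonneg (grad u x)) (norm_nonneg (grad v x))) ha
  have h0 : 0 ≤ ‖grad u x‖ ^ (D.p - 2) + D.a x * ‖grad u x‖ ^ (D.q - 2) := by positivity
  rw [phaseDensity, abs_mul, abs_of_nonneg h0]
  refine (mul_le_mul_of_nonneg_left (abs_real_inner_le_norm _ _) h0).trans ?_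
  unfold H
  linarith

lemma abs_hardyDensity_le (hp : 2 ≤ D.p) (u v : D.W0) {x : EuclideanSpace ℝ (Fin N)}
    (hx : x ∈ D.Ω) (hx0 : x ≠ 0) : |hardyDensity u v x| ≤ hardyH u x + hardyH v x := by
  have ha := a_nonneg' hx
  have hq : 2 ≤ D.q := hp.trans D.p_lt_q.le
  have e : ∀ m : ℝ, 2 ≤ m →
      |(|fn u x / ‖x‖| ^ (m - 2) * (fn u x / ‖x‖) * (fn v x / ‖x‖))| ≤
        (|fn u x| / ‖x‖) ^ m + (|fn v x| / ‖x‖) ^ m := fun m hm => by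
    have h := rpow_sub_two_mul_mul_le hm (abs_nonneg (fn u x / ‖x‖)) (abs_nonneg (fn v x / ‖x‖))
    rw [abs_mul, abs_mul, abs_of_nonneg (Real.rpow_nonneg (abs_nonneg (fn u x / ‖x‖)) _)]
    refine h.trans (le_of_eq ?_)
    rw [abs_div, abs_div, abs_norm]
  rw [hardyDensity_eq u v hx0]
  refine (abs_add_le _ _).trans ?_
  rw [abs_mul (D.a x), abs_of_nonneg ha]
  have h1 := e _ hp
  have h2 := mul_le_mul_of_nonneg_left (e _ hq) ha
  unfold hardyH
  linarith

lemma integrable_phaseDensity (hp : 2 ≤ D.p) (u v : D.W0) :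
    Integrable (phaseDensity u v) D.μ := by
  have hn := (aestronglyMeasurable_grad u).norm.aemeasurable
  have hm : AEMeasurable (phaseDensity u v) D.μ :=
    ((hn.pow_const _).add ((aemeasurable_a D).mul (hn.pow_const _))).mul
      ((aestronglyMeasurable_grad u).inner (𝕜 := ℝ) (aestronglyMeasurable_grad v)).aemeasurable
  refine ((integrable_H_grad u).add (integrable_H_grad v)).mono' hm.aestronglyMeasurable ?_
  filter_upwards [ae_restrict_mem D.isOpen.measurableSet] with x hx
    using abs_phaseDensity_le hp u v hx

lemma integrable_hardyDensity (hp : 2 ≤ D.p) (u v : D.W0) :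
    Integrable (hardyDensity u v) D.μ := by
  have hu := (aestronglyMeasurable_fn u).aemeasurable
  have hv := (aestronglyMeasurable_fn v).aemeasurable
  have hun : AEMeasurable (fun x => |fn u x|) D.μ := (aestronglyMeasurable_fn u).norm.aemeasurable
  have hx : ∀ m : ℝ, AEMeasurable (fun x : EuclideanSpace ℝ (Fin N) => ‖x‖ ^ m) D.μ := fun m =>
    measurable_norm.aemeasurable.pow_const m
  have hm : AEMeasurable (hardyDensity u v) D.μ :=
    ((((hun.pow_const _).mul hu).div (hx _)).mul hv).add
      (((aemeasurable_a D).mul (((hun.pow_const _).mul hu).div (hx _))).mul hv)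
  refine ((integrable_hardyH u).add (integrable_hardyH v)).mono' hm.aestronglyMeasurable ?_
  filter_upwards [ae_restrict_mem D.isOpen.measurableSet, ae_ne_zero D] with x hx hx0
    using abs_hardyDensity_le hp u v hx hx0

lemma integral_H_grad_le_one {u : D.W0} (hu : ‖u‖ < 1) : ∫ x in D.Ω, D.H x ‖grad u x‖ ≤ 1 := by
  have h : D.modular (grad u) ≤ ENNReal.ofReal 1 :=
    LH.modular_le_of_norm_lt ((norm_snd_le u).trans_lt hu) le_rfl
  rw [← ofReal_integral_H_grad] at h
  exact (ENNReal.ofReal_le_ofReal_iff zero_le_one).1 h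

lemma exists_integral_H_grad_le {M : ℝ} :
    ∃ K : ℝ, ∀ u : D.W0, ‖u‖ ≤ M → ∫ x in D.Ω, D.H x ‖grad u x‖ ≤ K := by
  refine ⟨(max 1 (M + 1)) ^ D.q, fun u hu => ?_⟩
  have h : D.modular (grad u) ≤ ENNReal.ofReal ((max 1 (M + 1)) ^ D.q) :=
    LH.modular_le_rpow_of_norm_lt
      (((norm_snd_le u).trans hu).trans_lt ((lt_add_one M).trans_le (le_max_right _ _)))
      (le_max_left _ _)
  rw [← ofReal_integral_H_grad] at h
  exact (ENNReal.ofReal_le_ofReal_iff (by positivity)).1 h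

/-- The operator `L_γ`. -/
lemma exists_isOperatorL (hp : 2 ≤ D.p) (γ : ℝ) :
    ∃ L : D.W0 → StrongDual ℝ D.W0, IsOperatorL γ L := by
  set c := (min (hardyConstant N D.p) (hardyConstant N D.q))⁻¹ with hc
  have hc0 : 0 ≤ c := (inv_pos.2 (hardyConstant_min_pos D)).le
  have hA : ∀ u v : D.W0, |∫ x in D.Ω, phaseDensity u v x| ≤
      (∫ x in D.Ω, D.H x ‖grad u x‖) + ∫ x in D.Ω, D.H x ‖grad v x‖ := fun u v => by
    rw [← integral_add (integrable_H_grad u) (integrable_H_grad v)]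
    refine abs_integral_le_integral_abs.trans (setIntegral_mono_on
      (integrable_phaseDensity hp u v).abs
      ((integrable_H_grad u).add (integrable_H_grad v)) D.isOpen.measurableSet
      fun x hx => abs_phaseDensity_le hp u v hx)
  have hB : ∀ u v : D.W0, |∫ x in D.Ω, hardyDensity u v x| ≤
      (∫ x in D.Ω, hardyH u x) + ∫ x in D.Ω, hardyH v x := fun u v => by
    rw [← integral_add (integrable_hardyH u) (integrable_hardyH v)]
    refine abs_integral_le_integral_abs.trans (integral_mono_ae
      (integrable_hardyDensity hp u v).abs
      ((integrable_hardyH u).add (integrable_hardyH v)) ?_)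
    filter_upwards [ae_restrict_mem D.isOpen.measurableSet, ae_ne_zero D] with x hx hx0
      using abs_hardyDensity_le hp u v hx hx0
  let T : D.W0 → D.W0 →ₗ[ℝ] ℝ := fun u =>
    { toFun := fun v => (∫ x in D.Ω, phaseDensity u v x) - γ * ∫ x in D.Ω, hardyDensity u v x
      map_add' := fun v w => by
        have e1 : ∫ x in D.Ω, phaseDensity u (v + w) x =
            (∫ x in D.Ω, phaseDensity u v x) + ∫ x in D.Ω, phaseDensity u w x := by
          rw [← integral_add (integrable_phaseDensity hp u v) (integrable_phaseDensity hp u w)]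
          refine integral_congr_ae ?_
          filter_upwards [grad_add v w] with x hx
          simp only [phaseDensity, hx, inner_add_right, mul_add]
        have e2 : ∫ x in D.Ω, hardyDensity u (v + w) x =
            (∫ x in D.Ω, hardyDensity u v x) + ∫ x in D.Ω, hardyDensity u w x := by
          rw [← integral_add (integrable_hardyDensity hp u v) (integrable_hardyDensity hp u w)]
          refine integral_congr_ae ?_
          filter_upwards [fn_add v w] with x hx
          simp only [hardyDensity, hx]
          ring
        rw [e1, e2]
        ring
      map_smul' := fun k v => by
        have e1 : ∫ x in D.Ω, phaseDensity u (k • v) x = k * ∫ x in D.Ω, phaseDensity u v x := by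
          rw [← integral_const_mul]
          refine integral_congr_ae ?_
          filter_upwards [grad_smul k v] with x hx
          simp only [phaseDensity, hx, real_inner_smul_right]
          ring
        have e2 : ∫ x in D.Ω, hardyDensity u (k • v) x = k * ∫ x in D.Ω, hardyDensity u v x := by
          rw [← integral_const_mul]
          refine integral_congr_ae ?_
          filter_upwards [fn_smul k v] with x hx
          simp only [hardyDensity, hx]
          ring
        rw [e1, e2, RingHom.id_apply, smul_eq_mul]
        ring }
  -- The modular bounds are not homogeneous in `v`, so they are used only on the ball of radius `1 /
  -- 2`, strictly inside the unit ball where the gradient modular is at most one; linearity then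
  -- extends the bound.
  have hT : ∀ u, ∃ C : ℝ, ∀ v, ‖T u v‖ ≤ C * ‖v‖ := fun u => by
    set I := ∫ x in D.Ω, D.H x ‖grad u x‖ with hI
    refine ⟨_, LinearMap.bound_of_ball_bound' (r := 1 / 2) (by norm_num)
      ((I + 1) + |γ| * (c * I + c)) (T u) fun v hv => ?_⟩
    have hv1 : ‖v‖ < 1 := by
      have := mem_closedBall_zero_iff.1 hv
      linarith
    have h1 := integral_H_grad_le_one hv1
    have h2 := hA u v
    have h3 := hB u v
    have h4 := integral_hardyH_le u
    have h5 := (integral_hardyH_le v).trans (mul_le_mul_of_nonneg_left h1 hc0)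
    rw [mul_one] at h5
    change |(∫ x in D.Ω, phaseDensity u v x) - γ * ∫ x in D.Ω, hardyDensity u v x| ≤ _
    refine (abs_sub _ _).trans (add_le_add (by linarith) ?_)
    rw [abs_mul]
    exact mul_le_mul_of_nonneg_left (by linarith) (abs_nonneg _)
  exact ⟨fun u => (T u).mkContinuousOfExistsBound (hT u), fun u v =>
    ⟨integrable_phaseDensity hp u v, integrable_hardyDensity hp u v, rfl⟩⟩

end Densities

/-! ### Coercivity, the Hardy remainder and property (S) -/

section TypeS

/-- Simon's inequality is applied pointwise to the two gradients, once with exponent `p` and once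
with exponent `q` and weight `a`. -/
lemma integral_H_grad_sub_le (hp : 2 ≤ D.p) {κp κq : ℝ} (hκp : IsSimonConstant N D.p κp)
    (hκq : IsSimonConstant N D.q κq) (u v : D.W0) :
    (max κp κq)⁻¹ * ∫ x in D.Ω, D.H x ‖grad (u - v) x‖ ≤
      ∫ x in D.Ω, (phaseDensity u (u - v) x - phaseDensity v (u - v) x) := by
  rw [← integral_const_mul]
  have hκ : 0 < max κp κq := lt_max_of_lt_left hκp.1
  refine integral_mono_ae ((integrable_H_grad _).const_mul _)
    ((integrable_phaseDensity hp u _).sub (integrable_phaseDensity hp v _)) ?_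
  filter_upwards [ae_restrict_mem D.isOpen.measurableSet, grad_sub u v] with x hx hg
  have ha := a_nonneg' hx
  have e : ∀ {m κ : ℝ}, IsSimonConstant N m κ → κ ≤ max κp κq →
      (max κp κq)⁻¹ * ‖grad u x - grad v x‖ ^ m ≤
        ‖grad u x‖ ^ (m - 2) * inner ℝ (grad u x) (grad u x - grad v x) -
          ‖grad v x‖ ^ (m - 2) * inner ℝ (grad v x) (grad u x - grad v x) := by
    intro m κ h hle
    have h1 := h.2 (grad u x) (grad v x)
    rw [inner_sub_left, real_inner_smul_left, real_inner_smul_left] at h1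
    have h2 : 0 ≤ ‖grad u x - grad v x‖ ^ m := by positivity
    -- Simon's inequality itself shows that the monotonicity term is nonnegative, so its constant
    -- may be enlarged to the maximum.
    have h3 := (mul_nonneg_iff_of_pos_left h.1).1 (h2.trans h1)
    rw [inv_mul_le_iff₀ hκ]
    exact h1.trans (mul_le_mul_of_nonneg_right hle h3)
  have h1 := e hκp (le_max_left _ _)
  have h2 := mul_le_mul_of_nonneg_left (e hκq (le_max_right _ _)) ha
  simp only [phaseDensity, H, hg]
  linarith

/-- The Brezis-Lieb inequality is used with `s = u_j / |x|` and `t = u₀ / |x|`. Its `ε` term is a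
multiple of the Hardy integrand of `u_j - u₀`, whose integrals stay bounded, and its other term is
integrable by Hardy's inequality for `u₀`. -/
lemma tendsto_integral_hardy_remainder (hp : 2 ≤ D.p) {u : ℕ → D.W0} {u₀ : D.W0} {K : ℝ}
    (hK : ∀ j, ∫ x in D.Ω, hardyH (u j - u₀) x ≤ K)
    (hae : ∀ᵐ x ∂D.μ, Tendsto (fun j => fn (u j) x) atTop (𝓝 (fn u₀ x))) :
    Tendsto (fun j => ∫ x in D.Ω, (hardyDensity (u j) (u j - u₀) x -
      hardyDensity u₀ (u j - u₀) x - hardyH (u j - u₀) x)) atTop (𝓝 0) := by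
  have hq : 2 ≤ D.q := hp.trans D.p_lt_q.le
  let Φ : ℝ → ℝ → ℝ → ℝ := fun m t s =>
    |s| ^ (m - 2) * s * (s - t) - |t| ^ (m - 2) * t * (s - t) - |s - t| ^ m
  have hΦ : ∀ m : ℝ, 2 ≤ m → ∀ t, Tendsto (Φ m t) (𝓝 t) (𝓝 0) := fun m hm t => by
    have hm2 : 0 ≤ m - 2 := by linarith
    have hm0 : 0 ≤ m := by linarith
    have hc : Continuous (Φ m t) := by
      have hs : Continuous fun s : ℝ => s - t := continuous_id.sub continuous_const
      exact ((((continuous_abs.rpow_const fun _ => Or.inr hm2).mul continuous_id).mul hs).sub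
        (continuous_const.mul hs)).sub (hs.abs.rpow_const fun _ => Or.inr hm0)
    have h0 : Φ m t t = 0 := by
      simp only [Φ, sub_self, mul_zero, abs_zero, Real.zero_rpow (by linarith : m ≠ 0)]
    simpa [h0] using hc.tendsto t
  have hid : ∀ᵐ x ∂D.μ, ∀ j, x ∈ D.Ω ∧
      hardyH (u j - u₀) x = |fn (u j) x / ‖x‖ - fn u₀ x / ‖x‖| ^ D.p +
        D.a x * |fn (u j) x / ‖x‖ - fn u₀ x / ‖x‖| ^ D.q ∧
      hardyDensity (u j) (u j - u₀) x - hardyDensity u₀ (u j - u₀) x - hardyH (u j - u₀) x =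
        Φ D.p (fn u₀ x / ‖x‖) (fn (u j) x / ‖x‖) +
          D.a x * Φ D.q (fn u₀ x / ‖x‖) (fn (u j) x / ‖x‖) := by
    filter_upwards [ae_all_iff.2 fun j => fn_sub (u j) u₀, ae_ne_zero D,
      ae_restrict_mem D.isOpen.measurableSet] with x h1 h2 h3 j
    have h4 : hardyH (u j - u₀) x = |fn (u j) x / ‖x‖ - fn u₀ x / ‖x‖| ^ D.p +
        D.a x * |fn (u j) x / ‖x‖ - fn u₀ x / ‖x‖| ^ D.q := by
      rw [hardyH, h1 j, ← sub_div, abs_div, abs_norm]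
    refine ⟨h3, h4, ?_⟩
    rw [hardyDensity_eq _ _ h2, hardyDensity_eq _ _ h2, h4, h1 j, sub_div]
    simp only [Φ]
    ring
  refine tendsto_integral_of_abs_le_add (h := fun j => hardyH (u j - u₀)) (K := K)
    (fun j => ((integrable_hardyDensity hp _ _).sub (integrable_hardyDensity hp _ _)).sub
      (integrable_hardyH _)) (fun j => integrable_hardyH _) (fun j => ?_) hK (fun ε hε => ?_) ?_
  · filter_upwards [ae_restrict_mem D.isOpen.measurableSet] with x hx using hardyH_nonneg _ hx
  · obtain ⟨Cp, hCp, hp'⟩ := exists_abs_brezisLieb_le hp hε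
    obtain ⟨Cq, hCq, hq'⟩ := exists_abs_brezisLieb_le hq hε
    refine ⟨fun x => (Cp + Cq) * hardyH u₀ x, (integrable_hardyH u₀).const_mul _, fun j => ?_⟩
    filter_upwards [hid] with x hx
    obtain ⟨h1, h2, h3⟩ := hx j
    have ha := a_nonneg' h1
    rw [h3, h2, hardyH, ← abs_norm x, ← abs_div, abs_norm]
    set s := fn (u j) x / ‖x‖
    set t := fn u₀ x / ‖x‖
    have e1 := hp' s t
    have e2 := mul_le_mul_of_nonneg_left (hq' s t) ha
    have e3 : 0 ≤ Cq * |t| ^ D.p := by positivity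
    have e4 : 0 ≤ D.a x * (Cp * |t| ^ D.q) := by positivity
    refine (abs_add_le _ _).trans ?_
    rw [abs_mul (D.a x), abs_of_nonneg ha]
    simp only [Φ]
    linarith
  · filter_upwards [hid, hae] with x hx hlim
    have hs : Tendsto (fun j => fn (u j) x / ‖x‖) atTop (𝓝 (fn u₀ x / ‖x‖)) :=
      hlim.div_const _
    have h := ((hΦ _ hp _).comp hs).add (((hΦ _ hq _).comp hs).const_mul (D.a x))
    rw [mul_zero, add_zero] at h
    exact h.congr fun j => ((hx j).2.2).symm

/-- A Poincaré inequality for the modular. -/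
lemma exists_modular_fn_le (D : DoublePhase N) :
    ∃ C : ℝ≥0∞, C ≠ ⊤ ∧ ∀ u : D.W0, D.modular (fn u) ≤ C * D.modular (grad u) := by
  -- On the bounded set `Ω` one has `|u| ≤ R |u| / |x|`, so the Poincaré inequality is a consequence
  -- of Hardy's.
  obtain ⟨R, hR⟩ := D.isBounded.exists_norm_le
  refine ⟨ENNReal.ofReal ((max 1 R) ^ D.q) *
    ENNReal.ofReal (min (hardyConstant N D.p) (hardyConstant N D.q))⁻¹,
    ENNReal.mul_ne_top ENNReal.ofReal_ne_top ENNReal.ofReal_ne_top, fun u => ?_⟩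
  rw [mul_assoc]
  refine le_trans ?_ (mul_le_mul_right (lintegral_hardyH_le u) _)
  rw [← lintegral_const_mul' _ _ ENNReal.ofReal_ne_top]
  refine lintegral_mono_ae ?_
  filter_upwards [ae_restrict_mem D.isOpen.measurableSet, ae_ne_zero D] with x hx hx0
  have hn : 0 < ‖x‖ := norm_pos_iff.2 hx0
  rw [← ENNReal.ofReal_mul (by positivity), hardyH_eq]
  refine ENNReal.ofReal_le_ofReal ((H_mono hx (norm_nonneg _) ?_).trans
    (H_mul_le hx (by positivity) (le_max_left _ _)))
  calc ‖fn u x‖ = ‖x‖ * (|fn u x| / ‖x‖) := by rw [mul_div_cancel₀ _ hn.ne', Real.norm_eq_abs]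
    _ ≤ _ := by
      gcongr
      exact (hR x hx).trans (le_max_right _ _)

lemma tendsto_of_integral_H_grad {u : ℕ → D.W0} {u₀ : D.W0}
    (h : Tendsto (fun j => ∫ x in D.Ω, D.H x ‖grad (u j - u₀) x‖) atTop (𝓝 0)) :
    Tendsto u atTop (𝓝 u₀) := by
  have h1 : Tendsto (fun j => D.modular (grad (u j - u₀))) atTop (𝓝 0) := by
    have := ENNReal.tendsto_ofReal h
    rw [ENNReal.ofReal_zero] at this
    exact this.congr fun j => ofReal_integral_H_grad _
  obtain ⟨C, hC, hle⟩ := exists_modular_fn_le D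
  have h2 : Tendsto (fun j => D.modular (fn (u j - u₀))) atTop (𝓝 0) := by
    have := ENNReal.Tendsto.const_mul h1 (a := C) (Or.inr hC)
    rw [mul_zero] at this
    exact tendsto_of_tendsto_of_tendsto_of_le_of_le tendsto_const_nhds this (fun _ => zero_le)
      fun j => hle _
  have h3 := (LH.tendsto_norm_zero_of_modular (f := fun j => (u j - u₀).1.1.fst) h2).add
    (LH.tendsto_norm_zero_of_modular (f := fun j => (u j - u₀).1.1.snd) h1)
  rw [add_zero] at h3
  rw [tendsto_iff_norm_sub_tendsto_zero]
  exact h3.congr fun j => (norm_W0 _).symm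

/-- The Hardy term of the difference is absorbed into the coercive gradient term; this is where the
bound on `γ` enters. -/
lemma tendsto_of_ae_tendsto (hp : 2 ≤ D.p) {κp κq γ : ℝ}
    (hκp : IsSimonConstant N D.p κp) (hκq : IsSimonConstant N D.q κq)
    (hγ : γ < min (hardyConstant N D.p) (hardyConstant N D.q) / max κp κq)
    {L : D.W0 → StrongDual ℝ D.W0} (hL : IsOperatorL γ L) {u : ℕ → D.W0} {u₀ : D.W0} {M : ℝ}
    (hM : ∀ j, ‖u j - u₀‖ ≤ M)
    (hae : ∀ᵐ x ∂D.μ, Tendsto (fun j => fn (u j) x) atTop (𝓝 (fn u₀ x)))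
    (hlim : Tendsto (fun j => (L (u j) - L u₀) (u j - u₀)) atTop (𝓝 0)) :
    Tendsto u atTop (𝓝 u₀) := by
  have hκ : 0 < max κp κq := lt_max_of_lt_left hκp.1
  have hmin := hardyConstant_min_pos D
  set κ := max κp κq
  set c := (min (hardyConstant N D.p) (hardyConstant N D.q))⁻¹ with hc
  have hc0 : 0 < c := inv_pos.2 hmin
  obtain ⟨K, hK⟩ := exists_integral_H_grad_le (D := D) (M := M)
  set ρ : ℕ → ℝ := fun j => ∫ x in D.Ω, D.H x ‖grad (u j - u₀) x‖ with hρ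
  set h : ℕ → ℝ := fun j => ∫ x in D.Ω, hardyH (u j - u₀) x with hh
  set r : ℕ → ℝ := fun j => ∫ x in D.Ω, (hardyDensity (u j) (u j - u₀) x -
      hardyDensity u₀ (u j - u₀) x - hardyH (u j - u₀) x) with hr
  have hρ0 : ∀ j, 0 ≤ ρ j := fun j => integral_H_grad_nonneg _
  have hh0 : ∀ j, 0 ≤ h j := fun j => integral_hardyH_nonneg _
  have hhρ : ∀ j, h j ≤ c * ρ j := fun j => integral_hardyH_le _
  have hr0 : Tendsto r atTop (𝓝 0) :=
    tendsto_integral_hardy_remainder hp (K := c * K) (fun j => (hhρ j).trans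
      (mul_le_mul_of_nonneg_left (hK _ (hM j)) hc0.le)) hae
  -- For `γ ≤ 0` the Hardy term has a favourable sign and is dropped, hence the positive part of
  -- `γ`; positivity is then the hypothesis on `γ`, rearranged.
  have hθ : 0 < κ⁻¹ - max γ 0 * c := by
    rw [sub_pos, hc, ← div_eq_mul_inv, div_lt_iff₀ hmin, inv_mul_eq_div]
    exact max_lt hγ (div_pos hmin hκ)
  have hle : ∀ j, (κ⁻¹ - max γ 0 * c) * ρ j ≤ (L (u j) - L u₀) (u j - u₀) + γ * r j := fun j => by
    have h1 : (L (u j) - L u₀) (u j - u₀) =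
        (∫ x in D.Ω, (phaseDensity (u j) (u j - u₀) x - phaseDensity u₀ (u j - u₀) x)) -
          γ * (r j + h j) := by
      have hd := (integrable_hardyDensity hp (u j) (u j - u₀)).sub
        (integrable_hardyDensity hp u₀ (u j - u₀))
      have h2 : r j = (∫ x in D.Ω, hardyDensity (u j) (u j - u₀) x) -
          (∫ x in D.Ω, hardyDensity u₀ (u j - u₀) x) - h j := by
        rw [← integral_sub (integrable_hardyDensity hp _ _) (integrable_hardyDensity hp _ _)]
        exact integral_sub hd (integrable_hardyH _)
      rw [sub_apply, (hL _ _).2.2, (hL _ _).2.2, h2,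
        integral_sub (integrable_phaseDensity hp _ _) (integrable_phaseDensity hp _ _)]
      ring
    have h2 : κ⁻¹ * ρ j ≤ _ := integral_H_grad_sub_le hp hκp hκq (u j) u₀
    have h3 : γ * h j ≤ max γ 0 * (c * ρ j) :=
      (mul_le_mul_of_nonneg_right (le_max_left _ _) (hh0 j)).trans
        (mul_le_mul_of_nonneg_left (hhρ j) (le_max_right _ _))
    rw [h1]
    linarith
  have hρlim : Tendsto (fun j => (κ⁻¹ - max γ 0 * c) * ρ j) atTop (𝓝 0) := by
    have h1 := hlim.add (hr0.const_mul γ)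
    rw [mul_zero, add_zero] at h1
    exact squeeze_zero (fun j => mul_nonneg hθ.le (hρ0 j)) hle h1
  refine tendsto_of_integral_H_grad ?_
  have h1 := hρlim.const_mul (κ⁻¹ - max γ 0 * c)⁻¹
  rw [mul_zero] at h1
  exact h1.congr fun j => inv_mul_cancel_left₀ hθ.ne' _

end TypeS

end DoublePhase

end

theorem lemma3p3 {N : ℕ} (D : DoublePhase N) (hp : 2 ≤ D.p) (κp κq : ℝ)
    (hκp : IsSimonConstant N D.p κp) (hκq : IsSimonConstant N D.q κq) (γ : ℝ)
    (hγ : γ < min (hardyConstant N D.p) (hardyConstant N D.q) / max κp κq) :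
    ∃ L : D.W0 → StrongDual ℝ D.W0, DoublePhase.IsOperatorL γ L ∧ IsTypeS L := by
  obtain ⟨L, hL⟩ := DoublePhase.exists_isOperatorL hp γ
  refine ⟨L, hL, fun u u₀ hweak hlim => ?_⟩
  have hw : ∀ f : StrongDual ℝ D.W0, Tendsto (fun j => f (u j - u₀)) atTop (𝓝 0) := fun f => by
    have := (hweak f).sub_const (f u₀)
    rw [sub_self] at this
    exact this.congr fun j => (map_sub f _ _).symm
  obtain ⟨M, hM⟩ := exists_bound_of_weakly_convergent (u := fun j => u j - u₀) (u₀ := 0)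
    (fun f => by rw [map_zero]; exact hw f)
  -- A.e. convergence is available only along subsequences, so it is enough that every subsequence
  -- has a further one converging in norm to `u₀`.
  refine tendsto_of_subseq_tendsto fun ns hns => ?_
  obtain ⟨ms, hms, hae⟩ := DoublePhase.exists_subseq_tendsto_fn (v := fun k => u (ns k)) (u := u₀)
    ((DoublePhase.tendsto_lintegral_fn_of_weak hw).comp hns)
  exact ⟨ms, DoublePhase.tendsto_of_ae_tendsto hp hκp hκq hγ hL (fun j => hM (ns (ms j))) hae
    (hlim.comp (hns.comp hms.tendsto_atTop))⟩
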